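/- Let $\mathcal{S}$ (the Selberg class) be the set of Dirichlet series $F(s)=\sum_{n\ge 1} a_n n^{-s}$ (absolutely convergent for $\Re s>1$ by (2)) such that: (1) for some integer $m\ge 0$, $(s-1)^mF(s)$ continues to an entire function of finite order; (2) $a_n\ll_\varepsilon n^{\varepsilon}$ for every $\varepsilon>0$; (3) there are an integer $k\ge 0$ and $\gamma(s)=\epsilon Q^s\prod_{i=1}^k\Gamma(w_is+\mu_i)$ with $|\epsilon|=1$, $Q>0$, $w_i>0$, $\Re\mu_i\ge 0$, such that $\Phi(s)=\gamma(s)F(s)$ satisfies $\Phi(s)=\overline{\Phi(1-\bar s)}$ identically, as meromorphic functions; (4) $a_1=1$ and $\log F(s)=\sum_{n\ge 1} b_n n^{-s}$ for $\Re s>1$, where $b_n=0$ unless $n$ is a positive power of a prime, and $b_n\ll n^{\theta}$ for some $\theta<1/2$. Members of $\mathcal{S}$ are regarded as meromorphic functions on $\mathbb{C}$, holomorphic except for at most a pole at $s=1$. Call $F\in\mathcal{S}$ primitive if $F=F_1F_2$ with $F_1,F_2\in\mathcal{S}$ implies $F_1=1$ or $F_2=1$. **Corollary 3.3.** Every $F\in\mathcal{S}$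 can be written as a finite product $F=P_1P_2\cdots P_r$, $r\ge 0$, of primitive elements $P_i\in\mathcal{S}$ with $P_i\neq 1$ (the empty product, $r=0$, being the function $1$). -/

import Mathlib

open Filter Asymptotics

namespace SelbergClass

/-- The data of a gamma factor `γ(s) = ε Q ^ s ∏ i, Γ(w i * s + μ i)` with `|ε| = 1`, `Q > 0`,
`w i > 0` and `Re (μ i) ≥ 0`. The product may be empty (`k = 0`). -/
structure GammaFactor where
  k : ℕ
  ε : ℂ
  Q : ℝ
  w : Fin k → ℝ
  μ : Fin k → ℂ
  norm_ε : ‖ε‖ = 1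
  Q_pos : 0 < Q
  w_pos : ∀ i, 0 < w i
  re_μ_nonneg : ∀ i, 0 ≤ (μ i).re

/-- The value `ε Q ^ s ∏ i, Γ(w i * s + μ i)`, meaningful where `γ.IsRegularAt s`. -/
noncomputable def GammaFactor.eval (γ : GammaFactor) (s : ℂ) : ℂ :=
  γ.ε * (γ.Q : ℂ) ^ s * ∏ i, Complex.Gamma ((γ.w i : ℂ) * s + γ.μ i)

/-- `s` is not a pole of any of the factors `Γ(w i * s + μ i)`. -/
def GammaFactor.IsRegularAt (γ : GammaFactor) (s : ℂ) : Prop :=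
  ∀ i, ∀ n : ℕ, (γ.w i : ℂ) * s + γ.μ i ≠ -(n : ℂ)

/-- An entire function `E` has finite order: `E(s) = O(exp(|s| ^ ρ))` as `|s| → ∞`,
for some real `ρ`. -/
def HasFiniteOrder (E : ℂ → ℂ) : Prop :=
  ∃ ρ : ℝ, E =O[cocompact ℂ] fun s => Real.exp (‖s‖ ^ ρ)

/-- `F` is the Dirichlet series `∑ a n / n ^ s` in the half-plane `Re s > 1`. -/
def IsDirichletSeries (F : ℂ → ℂ) (a : ℕ → ℂ) : Prop :=
  ∀ s : ℂ, 1 < s.re → LSeriesSummable a s ∧ F s = LSeries a s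

/-- Analyticity: `(s - 1) ^ m * F s` is an entire function of finite order for some `m ≥ 0`.
The value `F 1` plays no role, as `F` may have a pole there. -/
def Analyticity (F : ℂ → ℂ) : Prop :=
  ∃ (m : ℕ) (E : ℂ → ℂ), Differentiable ℂ E ∧ HasFiniteOrder E ∧
    ∀ s : ℂ, s ≠ 1 → E s = (s - 1) ^ m * F s

/-- Ramanujan hypothesis: `a n ≪ n ^ ε` for every `ε > 0`. -/
def RamanujanHypothesis (a : ℕ → ℂ) : Prop :=
  ∀ ε : ℝ, 0 < ε → a =O[atTop] fun n : ℕ => (n : ℝ) ^ ε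

/-- The functional equation `Φ(s) = conj (Φ (1 - conj s))` for `Φ(s) = γ(s) F(s)`, at all points
`s` at which the functions `F` and `γ` have no poles at either of `s` and `1 - conj s`. -/
def FunctionalEquation (F : ℂ → ℂ) (γ : GammaFactor) : Prop :=
  ∀ s : ℂ, s ≠ 0 → s ≠ 1 → γ.IsRegularAt s → γ.IsRegularAt (1 - star s) →
    γ.eval s * F s = star (γ.eval (1 - star s) * F (1 - star s))

/-- Euler product: `a 1 = 1` and `log F(s) = ∑ b n / n ^ s` for `Re s > 1`, where `b n = 0` unless
`n` is a positive power of a prime, and `b n ≪ n ^ θ` for some `θ < 1/2`. As `b 1 = 0`, the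
series is the branch of `log F` that tends to `0` as `Re s → ∞`. -/
def EulerProduct (F : ℂ → ℂ) (a : ℕ → ℂ) : Prop :=
  a 1 = 1 ∧ ∃ b : ℕ → ℂ,
    (∀ s : ℂ, 1 < s.re → LSeriesSummable b s ∧ F s = Complex.exp (LSeries b s)) ∧
    (∀ n, ¬ IsPrimePow n → b n = 0) ∧
    ∃ θ : ℝ, θ < 1 / 2 ∧ b =O[atTop] fun n : ℕ => (n : ℝ) ^ θ

/-- `F` belongs to the Selberg class. A member is a function on `ℂ` with at most a pole at `1`;
it is represented by `F : ℂ → ℂ` with an arbitrary value `F 1`, and two such functions are the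
same member when they agree on `{1}ᶜ`. -/
def IsSelberg (F : ℂ → ℂ) : Prop :=
  ∃ a : ℕ → ℂ, IsDirichletSeries F a ∧ Analyticity F ∧ RamanujanHypothesis a ∧
    (∃ γ : GammaFactor, FunctionalEquation F γ) ∧ EulerProduct F a

/-- `F` is a primitive member of the Selberg class: `F = F₁ F₂` with `F₁`, `F₂` in the class
implies `F₁ = 1` or `F₂ = 1`. -/
def IsPrimitive (F : ℂ → ℂ) : Prop :=
  IsSelberg F ∧ ∀ F₁ F₂ : ℂ → ℂ, IsSelberg F₁ → IsSelberg F₂ →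
    Set.EqOn F (F₁ * F₂) {1}ᶜ → Set.EqOn F₁ 1 {1}ᶜ ∨ Set.EqOn F₂ 1 {1}ᶜ

end SelbergClass

/-! To a gamma factor attach the degree `2 * ∑ i, γ.w i`. It is superadditive under products
(`degree_add_le_of_eqOn_mul`), and a member admitting a gamma factor of degree below one is `1`
(`eqOn_one_of_degree_lt_one`). Hence splitting off a nontrivial factor costs at least one unit of
degree, and repeated splitting terminates. Invariance of the degree is never needed: the inequality
holds for any choice of gamma factors.

Superadditivity: on `Re s = -σ` the functional equation and the Euler product give `F` the size `|t|
^ (d * (σ + 1/2))`, up to a factor `|t| ^ (±k)` independent of `σ`. Comparing growth and letting `σ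
→ ∞` removes the loss.

Small degree: integrating `F` against a kernel that isolates the coefficient at `N` and moving the
line to `-σ` bounds `a N` by roughly `N ^ (k - 1 - σ)`, provided `F` times a polynomial grows at
most like `|t| ^ (k - 2)` there (`exists_coefficient_bound`). When `d < 1`, `k` can be chosen with
`σ - k` arbitrarily large, so the coefficients decay faster than any power and the Dirichlet series
converges everywhere. It is then bounded on every vertical line, which forces `d = 0`.

Degree zero: there are no Gamma factors, and letting `σ → ∞` in the coefficient bound leaves a
Dirichlet polynomial. Then `b` lives on powers of finitely many primes, so `log F` converges
absolutely for `Re s > θ`, and `F` is bounded above and away from zero on `Re s ≥ 1/2`. The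
functional equation carries one of these bounds to the left half-plane, and Liouville's theorem
applied to `F` or `1 / F` finishes. -/

namespace SelbergClass

/-! ### Ratios of Gamma values on vertical lines -/

open Complex in
/-- For fixed `τ`, the quotient `‖Γ(x + iτ)‖ / Γ(x)` is monotone in `x > 0`. -/
lemma norm_Gamma_div_le {x y : ℝ} (hx : 0 < x) (hxy : x ≤ y) (τ : ℝ) :
    ‖Gamma (x + τ * I)‖ ≤ Real.Gamma x / Real.Gamma y * ‖Gamma (y + τ * I)‖ := by
  rcases hxy.eq_or_lt with rfl | hlt
  · rw [div_self (Real.Gamma_pos_of_pos hx).ne', one_mul]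
  set h := y - x with hh
  have hh0 : 0 < h := sub_pos.mpr hlt
  have hyx : x + h = y := by ring
  have hΓh : 0 < Real.Gamma h := Real.Gamma_pos_of_pos hh0
  have hΓy : 0 < Real.Gamma y := Real.Gamma_pos_of_pos (hx.trans hlt)
  have key := Gamma_mul_Gamma_eq_betaIntegral (s := (x + τ * I : ℂ)) (t := (h : ℂ))
    (by simpa using hx) (by simpa using hh0)
  have key2 := Gamma_mul_Gamma_eq_betaIntegral (s := (x : ℂ)) (t := (h : ℂ))
    (by simpa using hx) (by simpa using hh0)
  have e1 : (x + τ * I + h : ℂ) = y + τ * I := by rw [← hyx]; push_cast; ring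
  have e2 : (x + h : ℂ) = (y : ℂ) := by rw [← hyx]; push_cast; ring
  rw [e1] at key
  rw [e2] at key2
  -- Triangle inequality in the Beta integral: `u ^ (iτ)` has modulus one.
  have hB : ‖betaIntegral (x + τ * I) h‖ ≤ ‖betaIntegral (x : ℂ) h‖ := by
    have hreal : betaIntegral (x : ℂ) h
        = ((∫ u in (0:ℝ)..1, u ^ (x - 1) * (1 - u) ^ (h - 1) : ℝ) : ℂ) := by
      rw [betaIntegral, ← intervalIntegral.integral_ofReal]
      refine intervalIntegral.integral_congr fun u hu => ?_
      rw [Set.uIcc_of_le zero_le_one] at hu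
      rw [ofReal_mul, ofReal_cpow hu.1, ofReal_cpow (sub_nonneg.mpr hu.2)]
      push_cast
      rfl
    have hnn : 0 ≤ ∫ u in (0:ℝ)..1, u ^ (x - 1) * (1 - u) ^ (h - 1) :=
      intervalIntegral.integral_nonneg zero_le_one fun u hu =>
        mul_nonneg (Real.rpow_nonneg hu.1 _) (Real.rpow_nonneg (sub_nonneg.mpr hu.2) _)
    rw [hreal, norm_real, Real.norm_of_nonneg hnn, betaIntegral]
    refine (intervalIntegral.norm_integral_le_integral_norm zero_le_one).trans (le_of_eq ?_)
    rw [intervalIntegral.integral_of_le zero_le_one, intervalIntegral.integral_of_le zero_le_one,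
      MeasureTheory.integral_Ioc_eq_integral_Ioo, MeasureTheory.integral_Ioc_eq_integral_Ioo]
    refine MeasureTheory.setIntegral_congr_fun measurableSet_Ioo fun u hu => ?_
    have h1 : (1 - u : ℂ) = ((1 - u : ℝ) : ℂ) := by push_cast; rfl
    rw [norm_mul, norm_cpow_eq_rpow_re_of_pos hu.1, h1,
      norm_cpow_eq_rpow_re_of_pos (sub_pos.mpr hu.2)]
    simp
  have n1 := congrArg norm key
  have n2 := congrArg norm key2
  simp only [norm_mul, Gamma_ofReal, norm_real, Real.norm_of_nonneg hΓh.le,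
    Real.norm_of_nonneg hΓy.le, Real.norm_of_nonneg (Real.Gamma_pos_of_pos hx).le] at n1 n2
  have hBeq : ‖betaIntegral (x : ℂ) h‖ = Real.Gamma x * Real.Gamma h / Real.Gamma y := by
    field_simp
    linarith
  have : ‖Gamma (x + τ * I)‖ * Real.Gamma h
      ≤ ‖Gamma (y + τ * I)‖ * (Real.Gamma x * Real.Gamma h / Real.Gamma y) := by
    rw [n1, ← hBeq]
    gcongr
  refine le_of_mul_le_mul_right (this.trans (le_of_eq ?_)) hΓh
  ring

lemma eventually_cocompact_le_abs (T : ℝ) : ∀ᶠ t : ℝ in cocompact ℝ, T ≤ |t| := by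
  have := (tendsto_norm_cocompact_atTop (E := ℝ)).eventually (eventually_ge_atTop T)
  simpa using this

lemma isTheta_affine {w : ℝ} (hw : w ≠ 0) (v : ℝ) :
    (fun t : ℝ => w * t + v) =Θ[cocompact ℝ] fun t : ℝ => t := by
  have h1 : (fun _ : ℝ => v) =o[cocompact ℝ] fun t : ℝ => w * t := by
    rw [isLittleO_const_left]
    right
    have := (tendsto_norm_cocompact_atTop (E := ℝ)).const_mul_atTop (abs_pos.mpr hw)
    refine this.congr fun t => ?_
    simp
  have h2 : (fun t : ℝ => w * t + v) =Θ[cocompact ℝ] fun t : ℝ => w * t :=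
    h1.right_isTheta_add'.symm
  exact h2.trans ((isTheta_refl _ _).const_mul_left hw)

lemma tendsto_affine_cocompact {w : ℝ} (hw : w ≠ 0) (v : ℝ) :
    Tendsto (fun t : ℝ => w * t + v) (cocompact ℝ) (cocompact ℝ) := by
  have := ((Homeomorph.mulLeft₀ w hw).trans (Homeomorph.addRight v)).isClosedEmbedding
  exact this.tendsto_cocompact

-- Iterate `Γ(z + 1) = z Γ(z)`, where `|z|` is comparable to `|τ|`. The poles are real, so large
-- `|τ|` avoids them for every `x`.
open Complex in
lemma Gamma_add_nat_isTheta (x : ℝ) (n : ℕ) :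
    (fun τ : ℝ => Gamma ((x + n : ℝ) + τ * I)) =Θ[cocompact ℝ]
      fun τ : ℝ => τ ^ n • Gamma (x + τ * I) := by
  induction n with
  | zero => simpa using isTheta_refl (fun τ : ℝ => Gamma (x + τ * I)) (cocompact ℝ)
  | succ n ih =>
    have h1 : (fun τ : ℝ => ((x + n : ℝ) + τ * I : ℂ)) =Θ[cocompact ℝ] fun τ : ℝ => τ := by
      have ha : (fun τ : ℝ => (τ * I : ℂ)) =Θ[cocompact ℝ] fun τ : ℝ => τ :=
        IsTheta.of_norm_eventuallyEq_norm (Eventually.of_forall fun τ => by simp)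
      have hb : (fun _ : ℝ => ((x + n : ℝ) : ℂ)) =o[cocompact ℝ] fun τ : ℝ => (τ * I : ℂ) := by
        rw [isLittleO_const_left]
        right
        refine (tendsto_norm_cocompact_atTop (E := ℝ)).congr fun t => ?_
        simp
      exact hb.right_isTheta_add.symm.trans ha
    have h2 : (fun τ : ℝ => Gamma ((x + (n + 1 : ℕ) : ℝ) + τ * I)) =ᶠ[cocompact ℝ]
        fun τ : ℝ => ((x + n : ℝ) + τ * I : ℂ) * Gamma ((x + n : ℝ) + τ * I) := by
      filter_upwards [eventually_cocompact_le_abs 1] with τ hτ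
      rw [← Gamma_add_one]
      · congr 1; push_cast; ring
      · intro h
        have := congrArg im h
        simp at this
        rw [this] at hτ
        norm_num at hτ
    refine h2.trans_isTheta ((h1.smul ih).trans ?_)
    refine EventuallyEq.isTheta (Eventually.of_forall fun τ => ?_)
    simp only [smul_smul, pow_succ']

open Complex in
/-- On vertical lines, `Γ(A + iτ) / Γ(B + iτ) ≪ |τ| ^ (A - B + 1)`. -/
lemma Gamma_isBigO_Gamma (A B : ℝ) :
    (fun τ : ℝ => Gamma (A + τ * I)) =O[cocompact ℝ]
      fun τ : ℝ => |τ| ^ (A - B + 1) • Gamma (B + τ * I) := by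
  -- Integer shifts `q` and `p` bring both abscissae into the range of `norm_Gamma_div_le`. Rounding
  -- `p` up is what costs the `+ 1` in the exponent.
  obtain ⟨q, hq⟩ := exists_nat_gt (max (-A) (B - A))
  have hA : 0 < A + q := by linarith [le_max_left (-A) (B - A)]
  have hAB : 0 ≤ A + q - B := by linarith [le_max_right (-A) (B - A)]
  set p := ⌈A + q - B⌉₊ with hp
  have hp1 : A + q ≤ B + p := by linarith [Nat.le_ceil (A + q - B)]
  have hp2 : (p : ℝ) ≤ A + q - B + 1 := (Nat.ceil_lt_add_one hAB).le
  have h1 : (fun τ : ℝ => Gamma ((A + q : ℝ) + τ * I)) =O[cocompact ℝ]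
      fun τ : ℝ => Gamma ((B + p : ℝ) + τ * I) :=
    IsBigO.of_bound _ (Eventually.of_forall fun τ => norm_Gamma_div_le hA hp1 τ)
  have h2 := ((Gamma_add_nat_isTheta A q).2.trans h1).trans (Gamma_add_nat_isTheta B p).1
  obtain ⟨C, hC0, hC⟩ := h2.exists_pos
  refine IsBigO.of_bound C ?_
  filter_upwards [hC.bound, eventually_cocompact_le_abs 1] with τ hτ h1τ
  have hpos : 0 < |τ| := by linarith
  rw [norm_smul, norm_smul, norm_pow, norm_pow, Real.norm_eq_abs] at hτ
  rw [norm_smul, Real.norm_of_nonneg (by positivity)]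
  have hle : |τ| ^ p ≤ |τ| ^ q * |τ| ^ (A - B + 1) := by
    rw [← Real.rpow_natCast, ← Real.rpow_natCast, ← Real.rpow_add hpos]
    exact Real.rpow_le_rpow_of_exponent_le h1τ (by linarith)
  refine le_of_mul_le_mul_left (hτ.trans ?_) (pow_pos hpos q)
  calc C * (|τ| ^ p * ‖Gamma (B + τ * I)‖)
      ≤ C * ((|τ| ^ q * |τ| ^ (A - B + 1)) * ‖Gamma (B + τ * I)‖) := by gcongr
    _ = _ := by ring

end SelbergClass

/-! ### Degree, growth on lines to the left, superadditivity -/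

namespace SelbergClass

/-- The degree `2 ∑ w i` of a gamma factor. -/
noncomputable def GammaFactor.degree (γ : GammaFactor) : ℝ := 2 * ∑ i, γ.w i

lemma GammaFactor.degree_nonneg (γ : GammaFactor) : 0 ≤ γ.degree :=
  mul_nonneg zero_le_two (Finset.sum_nonneg fun i _ => (γ.w_pos i).le)

lemma GammaFactor.k_eq_zero_of_degree_le_zero (γ : GammaFactor) (h : γ.degree ≤ 0) : γ.k = 0 := by
  by_contra hk
  have : 0 < ∑ i, γ.w i :=
    Finset.sum_pos (fun i _ => γ.w_pos i) ⟨⟨0, Nat.pos_of_ne_zero hk⟩, Finset.mem_univ _⟩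
  unfold GammaFactor.degree at h
  linarith

open Complex in
lemma GammaFactor.arg_eq (γ : GammaFactor) (i : Fin γ.k) (x t : ℝ) :
    (γ.w i : ℂ) * (x + t * I) + γ.μ i
      = ((γ.w i * x + (γ.μ i).re : ℝ) : ℂ) + ((γ.w i * t + (γ.μ i).im : ℝ) : ℂ) * I := by
  conv_lhs => rw [← re_add_im (γ.μ i)]
  push_cast
  ring

-- Each Gamma factor contributes `w i * (x - y) + 1`. The total loss `k` does not depend on `x` and
-- `y`, which makes it harmless once `x - y` tends to infinity.
open Complex in
lemma GammaFactor.eval_isBigO (γ : GammaFactor) (x y : ℝ) :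
    (fun t : ℝ => γ.eval (x + t * I)) =O[cocompact ℝ]
      fun t : ℝ => |t| ^ (γ.degree / 2 * (x - y) + γ.k) • γ.eval (y + t * I) := by
  have hprod : (fun t : ℝ => ∏ i, Gamma ((γ.w i : ℂ) * (x + t * I) + γ.μ i)) =O[cocompact ℝ]
      fun t : ℝ => ∏ i, (|t| ^ (γ.w i * (x - y) + 1) •
        Gamma ((γ.w i : ℂ) * (y + t * I) + γ.μ i)) := by
    refine IsBigO.finsetProd fun i _ => ?_
    have h1 := (Gamma_isBigO_Gamma (γ.w i * x + (γ.μ i).re) (γ.w i * y + (γ.μ i).re)).comp_tendsto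
      (tendsto_affine_cocompact (γ.w_pos i).ne' (γ.μ i).im)
    have h2 : (fun t : ℝ => |γ.w i * t + (γ.μ i).im| ^ (γ.w i * (x - y) + 1)) =Θ[cocompact ℝ]
        fun t : ℝ => |t| ^ (γ.w i * (x - y) + 1) := by
      refine IsTheta.rpow (Eventually.of_forall fun _ => abs_nonneg _)
        (Eventually.of_forall fun _ => abs_nonneg _) ?_
      exact (isTheta_affine (γ.w_pos i).ne' _).norm_left.norm_right
    simp only [Function.comp_def, ← γ.arg_eq] at h1
    refine h1.trans (IsBigO.smul ?_ (isBigO_refl _ _))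
    refine IsBigO.trans (EventuallyEq.isBigO (Eventually.of_forall fun t => ?_)) h2.1
    ring_nf
  have hQ : (fun t : ℝ => γ.ε * (γ.Q : ℂ) ^ (x + t * I : ℂ)) =O[cocompact ℝ]
      fun t : ℝ => γ.ε * (γ.Q : ℂ) ^ (y + t * I : ℂ) := by
    refine IsBigO.of_bound (γ.Q ^ (x - y)) (Eventually.of_forall fun t => le_of_eq ?_)
    rw [norm_mul, norm_mul, norm_cpow_eq_rpow_re_of_pos γ.Q_pos, norm_cpow_eq_rpow_re_of_pos γ.Q_pos,
      γ.norm_ε, one_mul, one_mul, ← Real.rpow_add γ.Q_pos]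
    simp
  refine (hQ.mul hprod).trans (EventuallyEq.isBigO ?_)
  filter_upwards [eventually_cocompact_le_abs 1] with t ht
  have htpos : 0 < |t| := by linarith
  have hexp : γ.degree / 2 * (x - y) + γ.k = ∑ i, (γ.w i * (x - y) + 1) := by
    rw [Finset.sum_add_distrib, ← Finset.sum_mul]
    simp [GammaFactor.degree]
  rw [GammaFactor.eval, hexp, Real.rpow_sum_of_pos htpos]
  simp only [real_smul, Finset.prod_mul_distrib, ofReal_prod]
  ring

lemma GammaFactor.eventually_im_ne_zero (γ : GammaFactor) :
    ∀ᶠ t : ℝ in cocompact ℝ, ∀ i, γ.w i * t + (γ.μ i).im ≠ 0 := by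
  rw [eventually_all]
  intro i
  have := (tendsto_affine_cocompact (γ.w_pos i).ne' (γ.μ i).im).eventually
    (eventually_cocompact_le_abs 1)
  filter_upwards [this] with t ht h0
  rw [h0] at ht
  norm_num at ht

open Complex in
lemma GammaFactor.isRegularAt_of_im_ne_zero (γ : GammaFactor) {x t : ℝ}
    (h : ∀ i, γ.w i * t + (γ.μ i).im ≠ 0) : γ.IsRegularAt (x + t * I) := by
  intro i n hn
  apply h i
  rw [γ.arg_eq] at hn
  simpa using congrArg im hn

lemma GammaFactor.eval_ne_zero (γ : GammaFactor) {s : ℂ} (h : γ.IsRegularAt s) :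
    γ.eval s ≠ 0 := by
  refine mul_ne_zero (mul_ne_zero ?_ ?_) (Finset.prod_ne_zero_iff.mpr fun i _ => ?_)
  · intro h0
    have := γ.norm_ε
    simp [h0] at this
  · exact fun h0 => γ.Q_pos.ne' (by exact_mod_cast (Complex.cpow_eq_zero_iff _ _).mp h0 |>.1)
  · exact Complex.Gamma_ne_zero fun n => h i n

lemma norm_LSeries_le_of_le_re {b : ℕ → ℂ} {c : ℝ} (hb : LSeriesSummable b c) {s : ℂ}
    (hs : c ≤ s.re) : ‖LSeries b s‖ ≤ ∑' n, ‖LSeries.term b c n‖ := by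
  have hle : ∀ n, ‖LSeries.term b s n‖ ≤ ‖LSeries.term b c n‖ := fun n =>
    LSeries.norm_term_le_of_re_le_re b (by simpa using hs) n
  refine (norm_tsum_le_tsum_norm (hb.norm.of_nonneg_of_le (fun _ => norm_nonneg _) hle)).trans ?_
  exact (hb.norm.of_nonneg_of_le (fun _ => norm_nonneg _) hle).tsum_le_tsum hle hb.norm

lemma exp_neg_le_norm_exp {z : ℂ} {B : ℝ} (h : ‖z‖ ≤ B) :
    Real.exp (-B) ≤ ‖Complex.exp z‖ ∧ ‖Complex.exp z‖ ≤ Real.exp B := by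
  rw [Complex.norm_exp]
  have := abs_le.mp ((Complex.abs_re_le_norm z).trans h)
  exact ⟨Real.exp_le_exp.mpr this.1, Real.exp_le_exp.mpr this.2⟩

/-- The series for `log F` is dominated by its absolute sum at `c`, so `F` is also bounded away from
zero. -/
lemma EulerProduct.norm_bounds {F : ℂ → ℂ} {a : ℕ → ℂ} (h : EulerProduct F a) {c : ℝ}
    (hc : 1 < c) :
    ∃ B : ℝ, ∀ s : ℂ, c ≤ s.re → Real.exp (-B) ≤ ‖F s‖ ∧ ‖F s‖ ≤ Real.exp B := by
  obtain ⟨-, b, hb, -⟩ := h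
  have hsum : LSeriesSummable b c := (hb c (by simpa using hc)).1
  refine ⟨∑' n, ‖LSeries.term b c n‖, fun s hs => ?_⟩
  rw [(hb s (hc.trans_le hs)).2]
  exact exp_neg_le_norm_exp (norm_LSeries_le_of_le_re hsum hs)

open Complex in
lemma FunctionalEquation.norm_eq {F : ℂ → ℂ} {γ : GammaFactor} (h : FunctionalEquation F γ)
    (σ : ℝ) :
    ∀ᶠ t : ℝ in cocompact ℝ,
      γ.eval ((-σ : ℝ) + t * I) ≠ 0 ∧ γ.eval ((1 + σ : ℝ) + t * I) ≠ 0 ∧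
      ‖γ.eval ((-σ : ℝ) + t * I)‖ * ‖F ((-σ : ℝ) + t * I)‖
        = ‖γ.eval ((1 + σ : ℝ) + t * I)‖ * ‖F ((1 + σ : ℝ) + t * I)‖ := by
  filter_upwards [γ.eventually_im_ne_zero, eventually_cocompact_le_abs 1] with t ht h1
  have hr1 := γ.isRegularAt_of_im_ne_zero (x := -σ) ht
  have hr2 := γ.isRegularAt_of_im_ne_zero (x := 1 + σ) ht
  refine ⟨γ.eval_ne_zero hr1, γ.eval_ne_zero hr2, ?_⟩
  -- The reflection keeps the height `t`, so both gamma values sit at the same height and can be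
  -- compared.
  have e : 1 - star (((-σ : ℝ) : ℂ) + t * I) = ((1 + σ : ℝ) : ℂ) + t * I := by
    apply Complex.ext <;> simp
  have him : ∀ z : ℂ, z.im = 0 → ((-σ : ℝ) : ℂ) + t * I ≠ z := by
    rintro z hz rfl
    have ht0 : t = 0 := by simpa using hz
    rw [ht0] at h1
    norm_num at h1
  have := h _ (him 0 rfl) (him 1 rfl) hr1 (by rwa [e])
  rw [e] at this
  simpa only [norm_mul, norm_star] using congrArg norm this

section LineAsymptotics

variable {F : ℂ → ℂ} {a : ℕ → ℂ} {γ : GammaFactor}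

open Complex in
lemma isBigO_on_left_line (hE : EulerProduct F a) (hγ : FunctionalEquation F γ) {σ : ℝ}
    (hσ : 0 < σ) :
    (fun t : ℝ => F ((-σ : ℝ) + t * I)) =O[cocompact ℝ]
      fun t : ℝ => |t| ^ (γ.degree * (σ + 1 / 2) + γ.k) := by
  obtain ⟨B, hB⟩ := hE.norm_bounds (c := 1 + σ) (by linarith)
  obtain ⟨C, hC0, hC⟩ := (γ.eval_isBigO (1 + σ) (-σ)).exists_pos
  refine IsBigO.of_bound (C * Real.exp B) ?_
  filter_upwards [hγ.norm_eq σ, hC.bound] with t ht hbd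
  obtain ⟨h0, -, heq⟩ := ht
  have hF := (hB ((1 + σ : ℝ) + t * I) (by simp)).2
  have hpos : 0 < ‖γ.eval ((-σ : ℝ) + t * I)‖ := norm_pos_iff.mpr h0
  rw [norm_smul] at hbd
  have hexp : γ.degree / 2 * (1 + σ - -σ) + γ.k = γ.degree * (σ + 1 / 2) + γ.k := by ring
  rw [hexp] at hbd
  refine le_of_mul_le_mul_left ?_ hpos
  rw [heq]
  calc _ ≤ (C * (‖|t| ^ (γ.degree * (σ + 1 / 2) + γ.k)‖ * ‖γ.eval ((-σ : ℝ) + t * I)‖))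
        * Real.exp B := by gcongr
    _ = _ := by ring

open Complex in
lemma isBigO_left_line (hE : EulerProduct F a) (hγ : FunctionalEquation F γ) {σ : ℝ}
    (hσ : 0 < σ) :
    (fun t : ℝ => |t| ^ (γ.degree * (σ + 1 / 2) - γ.k)) =O[cocompact ℝ]
      fun t : ℝ => F ((-σ : ℝ) + t * I) := by
  obtain ⟨B, hB⟩ := hE.norm_bounds (c := 1 + σ) (by linarith)
  obtain ⟨C, hC0, hC⟩ := (γ.eval_isBigO (-σ) (1 + σ)).exists_pos
  refine IsBigO.of_bound (C * Real.exp B) ?_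
  filter_upwards [hγ.norm_eq σ, hC.bound, eventually_cocompact_le_abs 1] with t hγt hbd ht
  obtain ⟨-, h0, heq⟩ := hγt
  have htpos : 0 < |t| := by linarith
  have hF := (hB ((1 + σ : ℝ) + t * I) (by simp)).1
  have hpos : 0 < ‖γ.eval ((1 + σ : ℝ) + t * I)‖ := norm_pos_iff.mpr h0
  rw [norm_smul, Real.norm_of_nonneg (by positivity)] at hbd
  have hexp : γ.degree / 2 * (-σ - (1 + σ)) + γ.k = -(γ.degree * (σ + 1 / 2) - γ.k) := by ring
  rw [hexp, Real.rpow_neg htpos.le] at hbd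
  rw [Real.norm_of_nonneg (by positivity)]
  set R := |t| ^ (γ.degree * (σ + 1 / 2) - γ.k) with hR
  have hRpos : 0 < R := by positivity
  have key : Real.exp (-B) ≤ C * R⁻¹ * ‖F ((-σ : ℝ) + t * I)‖ := by
    refine hF.trans (le_of_mul_le_mul_left ?_ hpos)
    rw [← heq]
    calc _ ≤ (C * (R⁻¹ * ‖γ.eval ((1 + σ : ℝ) + t * I)‖)) * ‖F ((-σ : ℝ) + t * I)‖ := by gcongr
      _ = _ := by ring
  rw [Real.exp_neg] at key
  have hBpos := Real.exp_pos B
  calc R = R * Real.exp B * (Real.exp B)⁻¹ := by field_simp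
    _ ≤ R * Real.exp B * (C * R⁻¹ * ‖F ((-σ : ℝ) + t * I)‖) := by gcongr
    _ = _ := by field_simp

end LineAsymptotics

lemma le_of_rpow_isBigO_rpow {p q : ℝ}
    (h : (fun t : ℝ => |t| ^ p) =O[cocompact ℝ] fun t : ℝ => |t| ^ q) : p ≤ q := by
  by_contra! hlt
  obtain ⟨C, hC⟩ := h.bound
  have h1 : Tendsto (fun t : ℝ => |t| ^ (p - q)) (cocompact ℝ) atTop :=
    (tendsto_rpow_atTop (sub_pos.mpr hlt)).comp tendsto_norm_cocompact_atTop
  obtain ⟨t, ht, ht1, htC⟩ :=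
    (hC.and ((eventually_cocompact_le_abs 1).and (h1.eventually (eventually_gt_atTop C)))).exists
  have htpos : 0 < |t| := by linarith
  rw [Real.norm_of_nonneg (by positivity), Real.norm_of_nonneg (by positivity)] at ht
  rw [Real.rpow_sub htpos, lt_div_iff₀ (by positivity)] at htC
  linarith

lemma le_of_forall_mul_add_le {d e K : ℝ} (h : ∀ σ : ℝ, 1 ≤ σ → d * σ ≤ e * σ + K) : d ≤ e := by
  by_contra! hlt
  have h1 := h (max 1 (K / (d - e) + 1)) (le_max_left _ _)
  have h2 : K / (d - e) + 1 ≤ max 1 (K / (d - e) + 1) := le_max_right _ _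
  have hpos : 0 < d - e := sub_pos.mpr hlt
  have h3 : K + (d - e) ≤ (d - e) * max 1 (K / (d - e) + 1) := by
    calc K + (d - e) = (d - e) * (K / (d - e) + 1) := by field_simp
      _ ≤ _ := by gcongr
  nlinarith

/-- The degree is superadditive on products (in fact additive). -/
lemma degree_add_le_of_eqOn_mul {F F₁ F₂ : ℂ → ℂ} {a a₁ a₂ : ℕ → ℂ} {γ γ₁ γ₂ : GammaFactor}
    (hE : EulerProduct F a) (hE₁ : EulerProduct F₁ a₁) (hE₂ : EulerProduct F₂ a₂)
    (hγ : FunctionalEquation F γ) (hγ₁ : FunctionalEquation F₁ γ₁)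
    (hγ₂ : FunctionalEquation F₂ γ₂) (hF : Set.EqOn F (F₁ * F₂) {1}ᶜ) :
    γ₁.degree + γ₂.degree ≤ γ.degree := by
  refine le_of_forall_mul_add_le
    -- All terms constant in `σ`, after dropping the nonnegative `(γ₁.degree + γ₂.degree) / 2` on
    -- the left.
    (K := γ.degree / 2 + γ.k + γ₁.k + γ₂.k) fun σ hσ => ?_
  have hσ0 : 0 < σ := by linarith
  have h12 := (isBigO_left_line hE₁ hγ₁ hσ0).mul (isBigO_left_line hE₂ hγ₂ hσ0)
  have heq : (fun t : ℝ => F₁ ((-σ : ℝ) + t * Complex.I) * F₂ ((-σ : ℝ) + t * Complex.I))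
      = fun t : ℝ => F ((-σ : ℝ) + t * Complex.I) := by
    funext t
    refine (hF fun h => ?_).symm
    have := congrArg Complex.re (Set.mem_singleton_iff.mp h)
    simp at this
    linarith
  rw [heq] at h12
  have h3 := h12.trans (isBigO_on_left_line hE hγ hσ0)
  have h4 := le_of_rpow_isBigO_rpow
    (p := (γ₁.degree * (σ + 1 / 2) - γ₁.k) + (γ₂.degree * (σ + 1 / 2) - γ₂.k))
    (h3.congr' ?_ EventuallyEq.rfl)
  · nlinarith [γ₁.degree_nonneg, γ₂.degree_nonneg]
  · filter_upwards [eventually_cocompact_le_abs 1] with t ht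
    rw [Real.rpow_add (by linarith)]

end SelbergClass

namespace SelbergClass

open Complex MeasureTheory Topology

/-! ### Shifting vertical contours -/

section ContourShift

lemma norm_sq_re_im (x t : ℝ) : ‖(x + t * I : ℂ)‖ ^ 2 = x ^ 2 + t ^ 2 := by
  rw [← normSq_eq_norm_sq, normSq_add_mul_I]

/-- Quadratic decay of an entire function away from the unit disc can be extended to the disc. -/
lemma exists_bound_of_decay {H : ℂ → ℂ} (hH : Continuous H) {a b C : ℝ}
    (hb : ∀ s : ℂ, a ≤ s.re → s.re ≤ b → 1 ≤ ‖s‖ → ‖H s‖ ≤ C / ‖s‖ ^ 2) :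
    ∃ M : ℝ, 0 ≤ M ∧ ∀ x t : ℝ, a ≤ x → x ≤ b → ‖H (x + t * I)‖ ≤ M * (1 + t ^ 2)⁻¹ := by
  obtain ⟨M₀, hM₀⟩ := (isCompact_closedBall (0 : ℂ) 1).exists_bound_of_continuousOn hH.continuousOn
  refine ⟨2 * max |C| |M₀|, by positivity, fun x t hax hxb => ?_⟩
  have h1t : 0 < 1 + t ^ 2 := by positivity
  rw [← div_eq_mul_inv, le_div_iff₀ h1t]
  rcases le_total ‖(x + t * I : ℂ)‖ 1 with h | h
  · have h2 := hM₀ (x + t * I) (by simpa using h)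
    have h3 : ‖(x + t * I : ℂ)‖ ^ 2 ≤ 1 := pow_le_one₀ (norm_nonneg _) h
    rw [norm_sq_re_im] at h3
    have h4 : 1 + t ^ 2 ≤ 2 := by nlinarith [sq_nonneg x]
    calc _ ≤ max |C| |M₀| * 2 := by
          gcongr
          exact h2.trans ((le_abs_self _).trans (le_max_right _ _))
      _ = _ := by ring
  · have h2 := hb (x + t * I) (by simpa using hax) (by simpa using hxb) h
    have h3 : 1 ≤ ‖(x + t * I : ℂ)‖ ^ 2 := one_le_pow₀ h
    rw [le_div_iff₀ (by linarith)] at h2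
    have h4 : 1 + t ^ 2 ≤ 2 * ‖(x + t * I : ℂ)‖ ^ 2 := by
      rw [norm_sq_re_im] at h3 ⊢
      nlinarith [sq_nonneg x]
    calc ‖H (x + t * I)‖ * (1 + t ^ 2) ≤ ‖H (x + t * I)‖ * (2 * ‖(x + t * I : ℂ)‖ ^ 2) := by gcongr
      _ = 2 * (‖H (x + t * I)‖ * ‖(x + t * I : ℂ)‖ ^ 2) := by ring
      _ ≤ _ := by
        gcongr
        exact h2.trans ((le_abs_self _).trans (le_max_left _ _))

lemma continuous_vertical (x : ℝ) : Continuous fun t : ℝ => (x + t * I : ℂ) := by fun_prop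

lemma integrable_vertical {H : ℂ → ℂ} (hH : Continuous H) {x M : ℝ}
    (hb : ∀ t : ℝ, ‖H (x + t * I)‖ ≤ M * (1 + t ^ 2)⁻¹) :
    Integrable fun t : ℝ => H (x + t * I) :=
  (integrable_inv_one_add_sq.const_mul M).mono' (hH.comp (continuous_vertical x)).aestronglyMeasurable
    (Eventually.of_forall hb)

/-- Shift of a vertical line of integration. -/
lemma integral_vertical_eq {H : ℂ → ℂ} (hH : Differentiable ℂ H) {a b M : ℝ} (hab : a ≤ b)
    (hb : ∀ x t : ℝ, a ≤ x → x ≤ b → ‖H (x + t * I)‖ ≤ M * (1 + t ^ 2)⁻¹) :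
    ∫ t : ℝ, H (a + t * I) = ∫ t : ℝ, H (b + t * I) := by
  have hia := integrable_vertical hH.continuous (fun t => hb a t le_rfl hab)
  have hib := integrable_vertical hH.continuous (fun t => hb b t hab le_rfl)
  have hta := intervalIntegral_tendsto_integral hia tendsto_neg_atTop_atBot tendsto_id
  have htb := intervalIntegral_tendsto_integral hib tendsto_neg_atTop_atBot tendsto_id
  have hdecay : Tendsto (fun T : ℝ => M * (1 + T ^ 2)⁻¹ * |b - a|) atTop (𝓝 0) := by
    have : Tendsto (fun T : ℝ => (1 + T ^ 2)⁻¹) atTop (𝓝 0) :=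
      (tendsto_atTop_add_const_left _ 1 (tendsto_pow_atTop two_ne_zero)).inv_tendsto_atTop
    simpa using (this.const_mul M).mul_const |b - a|
  have hh : ∀ ε : ℝ, ε = 1 ∨ ε = -1 → Tendsto (fun T : ℝ => ∫ x : ℝ in a..b, H (x + (ε * T : ℝ) * I))
      atTop (𝓝 0) := by
    intro ε hε
    refine squeeze_zero_norm (fun T => ?_) hdecay
    refine intervalIntegral.norm_integral_le_of_norm_le_const fun x hx => ?_
    rw [Set.uIoc_of_le hab] at hx
    have := hb x (ε * T) hx.1.le hx.2
    rcases hε with rfl | rfl <;> simpa using this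
  -- Cauchy's theorem on the rectangle of height `2T`; the horizontal sides vanish in the limit by
  -- `hh`.
  have key : ∀ T : ℝ, (∫ x : ℝ in a..b, H (x + ((-1 : ℝ) * T : ℝ) * I))
      - (∫ x : ℝ in a..b, H (x + ((1 : ℝ) * T : ℝ) * I))
      + I • (∫ y : ℝ in (-T)..T, H (b + y * I)) - I • (∫ y : ℝ in (-T)..T, H (a + y * I)) = 0 := by
    intro T
    have := integral_boundary_rect_eq_zero_of_differentiableOn H (a + (-T : ℝ) * I) (b + (T : ℝ) * I)
      hH.differentiableOn
    simpa using this
  have hlim := ((((hh (-1) (Or.inr rfl)).sub (hh 1 (Or.inl rfl))).add (htb.const_smul I)).sub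
    (hta.const_smul I))
  simp only [id] at hlim
  have hz := tendsto_nhds_unique (hlim.congr key) tendsto_const_nhds
  have : I * ((∫ t : ℝ, H (b + t * I)) - ∫ t : ℝ, H (a + t * I)) = 0 := by
    simpa [mul_sub] using hz
  rcases mul_eq_zero.mp this with h | h
  · exact absurd h I_ne_zero
  · exact (sub_eq_zero.mp h).symm

lemma norm_integral_vertical_le {H : ℂ → ℂ} {x M : ℝ}
    (hb : ∀ t : ℝ, ‖H (x + t * I)‖ ≤ M * (1 + t ^ 2)⁻¹) :
    ‖∫ t : ℝ, H (x + t * I)‖ ≤ M * Real.pi := by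
  refine (norm_integral_le_of_norm_le (integrable_inv_one_add_sq.const_mul M)
    (Eventually.of_forall hb)).trans (le_of_eq ?_)
  rw [integral_const_mul, integral_univ_inv_one_add_sq]

end ContourShift

/-! ### A kernel isolating one coefficient -/

section Kernel

/-- The entire function `sinh z / z`. -/
noncomputable def sinhc : ℂ → ℂ := dslope sinh 0

lemma differentiable_sinhc : Differentiable ℂ sinhc := by
  rw [← differentiableOn_univ, sinhc, differentiableOn_dslope univ_mem]
  exact differentiable_sinh.differentiableOn

lemma sinhc_of_ne_zero {z : ℂ} (hz : z ≠ 0) : sinhc z = sinh z / z := by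
  rw [sinhc, dslope_of_ne _ hz, slope_def_field]
  simp

lemma sinhc_mul_I (u : ℝ) : sinhc (u * I) = Real.sinc u := by
  rcases eq_or_ne u 0 with rfl | hu
  · simp [sinhc]
  · have : (u : ℂ) ≠ 0 := by exact_mod_cast hu
    rw [sinhc_of_ne_zero (mul_ne_zero this I_ne_zero), Real.sinc_of_ne_zero hu, sinh_mul_I]
    push_cast
    rw [mul_div_mul_right _ _ I_ne_zero]

lemma norm_sinhc_le {z : ℂ} (hz : z ≠ 0) : ‖sinhc z‖ ≤ Real.exp |z.re| / ‖z‖ := by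
  rw [sinhc_of_ne_zero hz, norm_div]
  gcongr
  rw [sinh, norm_div, RCLike.norm_ofNat, div_le_iff₀ two_pos]
  refine (norm_sub_le _ _).trans ?_
  rw [norm_exp, norm_exp, mul_two]
  gcongr
  · exact le_abs_self _
  · simpa using neg_le_abs z.re

lemma norm_sinhc_pow_le {δ : ℝ} (hδ : 0 < δ) (k : ℕ) {s : ℂ} (hs : s ≠ 0) :
    ‖sinhc (δ * s) ^ k‖ ≤ δ⁻¹ ^ k * Real.exp (k * δ * |s.re|) / ‖s‖ ^ k := by
  have h := norm_sinhc_le (z := δ * s) (mul_ne_zero (by exact_mod_cast hδ.ne') hs)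
  rw [norm_pow]
  refine (pow_le_pow_left₀ (norm_nonneg _) h k).trans (le_of_eq ?_)
  rw [re_ofReal_mul, abs_mul, abs_of_pos hδ, norm_mul, norm_real, Real.norm_of_nonneg hδ.le, div_pow,
    ← Real.exp_nat_mul, mul_pow, inv_pow, mul_assoc]
  field_simp

/-- The kernel `(s² - 1) ^ m (sinh(δs) / (δs)) ^ k e ^ (λs)`, whose inverse Mellin transform is
supported in a short interval. -/
noncomputable def kernel (m k : ℕ) (δ l : ℝ) (s : ℂ) : ℂ :=
  (s ^ 2 - 1) ^ m * (sinhc (δ * s) ^ k * exp (l * s))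

lemma differentiable_kernel (m k : ℕ) (δ l : ℝ) : Differentiable ℂ (kernel m k δ l) := by
  have := differentiable_sinhc
  unfold kernel
  fun_prop

lemma norm_sq_sub_one_pow_le (m : ℕ) {s : ℂ} (hs : 1 ≤ ‖s‖) :
    ‖(s ^ 2 - 1) ^ m‖ ≤ 2 ^ m * ‖s‖ ^ (2 * m) := by
  rw [norm_pow, pow_mul, ← mul_pow]
  gcongr
  refine (norm_sub_le _ _).trans ?_
  rw [norm_pow, norm_one]
  nlinarith

lemma norm_kernel_le {m k : ℕ} (hk : 2 * m + 2 ≤ k) {δ : ℝ} (hδ : 0 < δ) (l : ℝ) {s : ℂ}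
    (hs : 1 ≤ ‖s‖) :
    ‖kernel m k δ l s‖ ≤ 2 ^ m * δ⁻¹ ^ k * Real.exp (k * δ * |s.re| + l * s.re) / ‖s‖ ^ 2 := by
  have hs0 : s ≠ 0 := norm_pos_iff.mp (by linarith)
  have hpos : 0 < ‖s‖ := by linarith
  rw [kernel, norm_mul, norm_mul, norm_exp, re_ofReal_mul, Real.exp_add]
  calc _ ≤ (2 ^ m * ‖s‖ ^ (2 * m)) * ((δ⁻¹ ^ k * Real.exp (k * δ * |s.re|) / ‖s‖ ^ k)
        * Real.exp (l * s.re)) := by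
        gcongr
        · exact norm_sq_sub_one_pow_le m hs
        · exact norm_sinhc_pow_le hδ k hs0
    _ = 2 ^ m * δ⁻¹ ^ k * (Real.exp (k * δ * |s.re|) * Real.exp (l * s.re))
        * (‖s‖ ^ (2 * m) / ‖s‖ ^ k) := by ring
    _ ≤ 2 ^ m * δ⁻¹ ^ k * (Real.exp (k * δ * |s.re|) * Real.exp (l * s.re)) * (1 / ‖s‖ ^ 2) := by
        refine mul_le_mul_of_nonneg_left ?_ (by positivity)
        rw [div_le_div_iff₀ (by positivity) (by positivity), ← pow_add, one_mul]
        exact pow_le_pow_right₀ hs hk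
    _ = _ := by ring

lemma kernel_exists_bound {m k : ℕ} (hk : 2 * m + 2 ≤ k) {δ : ℝ} (hδ : 0 < δ) (l : ℝ) (a b : ℝ) :
    ∃ M : ℝ, 0 ≤ M ∧ ∀ x t : ℝ, a ≤ x → x ≤ b →
      ‖kernel m k δ l (x + t * I)‖ ≤ M * (1 + t ^ 2)⁻¹ := by
  refine exists_bound_of_decay (differentiable_kernel m k δ l).continuous
    (C := 2 ^ m * δ⁻¹ ^ k * Real.exp ((k * δ + |l|) * max |a| |b|)) fun s ha hb hs => ?_
  refine (norm_kernel_le hk hδ l hs).trans ?_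
  have hre : |s.re| ≤ max |a| |b| := abs_le_max_abs_abs ha hb
  gcongr
  rw [add_mul]
  refine add_le_add (by gcongr) ?_
  calc l * s.re ≤ |l * s.re| := le_abs_self _
    _ = |l| * |s.re| := abs_mul _ _
    _ ≤ _ := by gcongr

lemma integral_kernel_eq {m k : ℕ} (hk : 2 * m + 2 ≤ k) {δ : ℝ} (hδ : 0 < δ) (l : ℝ) (x y : ℝ) :
    ∫ t : ℝ, kernel m k δ l (x + t * I) = ∫ t : ℝ, kernel m k δ l (y + t * I) := by
  wlog hxy : x ≤ y generalizing x y
  · exact (this y x (le_of_not_ge hxy)).symm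
  obtain ⟨M, -, hM⟩ := kernel_exists_bound hk hδ l x y
  exact integral_vertical_eq (differentiable_kernel m k δ l) hxy hM

lemma norm_integral_kernel_le {m k : ℕ} (hk : 2 * m + 2 ≤ k) {δ : ℝ} (hδ : 0 < δ) (l : ℝ) {x : ℝ}
    (hx : 1 ≤ |x|) :
    ‖∫ t : ℝ, kernel m k δ l (x + t * I)‖
      ≤ 2 ^ m * δ⁻¹ ^ k * Real.exp (k * δ * |x| + l * x) * Real.pi := by
  refine norm_integral_vertical_le fun t => ?_
  have h1 : 1 + t ^ 2 ≤ ‖(x + t * I : ℂ)‖ ^ 2 := by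
    rw [norm_sq_re_im]
    nlinarith [sq_abs x]
  have h2 : 1 ≤ ‖(x + t * I : ℂ)‖ := by
    by_contra! h
    have : ‖(x + t * I : ℂ)‖ ^ 2 < 1 := pow_lt_one₀ (norm_nonneg _) h two_ne_zero
    nlinarith [sq_nonneg t]
  refine (norm_kernel_le hk hδ l h2).trans ?_
  rw [div_eq_mul_inv]
  simp only [add_re, ofReal_re, mul_re, I_re, mul_zero, ofReal_im, I_im, mul_one, sub_self, add_zero]
  gcongr

/-- A Paley–Wiener argument: on `Re s = x` the integral is `O(exp(kδ|x| + lx))`. Moving the line to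
infinity on the side where `l * x` is negative makes this tend to zero. -/
lemma integral_kernel_eq_zero {m k : ℕ} (hk : 2 * m + 2 ≤ k) {δ : ℝ} (hδ : 0 < δ) {l : ℝ}
    (hl : k * δ < |l|) (x : ℝ) : ∫ t : ℝ, kernel m k δ l (x + t * I) = 0 := by
  have hlim : Tendsto (fun y : ℝ => 2 ^ m * δ⁻¹ ^ k * Real.exp ((k * δ - |l|) * y) * Real.pi)
      atTop (𝓝 0) := by
    have h1 : Tendsto (fun y : ℝ => (k * δ - |l|) * y) atTop atBot :=
      tendsto_id.const_mul_atTop_of_neg (sub_neg.mpr hl)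
    simpa using ((Real.tendsto_exp_atBot.comp h1).const_mul (2 ^ m * δ⁻¹ ^ k)).mul_const Real.pi
  rw [← norm_eq_zero]
  refine le_antisymm (ge_of_tendsto hlim ?_) (norm_nonneg _)
  filter_upwards [eventually_ge_atTop 1] with y hy
  have hy0 : 0 ≤ y := by linarith
  rcases le_total 0 l with h | h
  · rw [integral_kernel_eq hk hδ l x (-y)]
    refine (norm_integral_kernel_le hk hδ l (by rwa [abs_neg, abs_of_nonneg hy0])).trans
      (le_of_eq ?_)
    rw [abs_neg, abs_of_nonneg hy0, abs_of_nonneg h]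
    ring_nf
  · rw [integral_kernel_eq hk hδ l x y]
    refine (norm_integral_kernel_le hk hδ l (by rwa [abs_of_nonneg hy0])).trans
      (le_of_eq ?_)
    rw [abs_of_nonneg hy0, abs_of_nonpos h]
    ring_nf

/-- On the imaginary axis `s² - 1 = -(1 + t²)`, so for even `k` the kernel has constant sign and its
integral cannot cancel. This is the reason for using `s² - 1` in place of `s - 1`. -/
lemma kernel_mul_I (m k : ℕ) (δ t : ℝ) :
    kernel m k δ 0 ((0 : ℝ) + t * I)
      = (-1) ^ m * (((1 + t ^ 2) ^ m * Real.sinc (δ * t) ^ k : ℝ) : ℂ) := by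
  have h1 : (((0 : ℝ) : ℂ) + t * I) ^ 2 - 1 = -1 * ((1 + t ^ 2 : ℝ) : ℂ) := by
    push_cast
    rw [zero_add, mul_pow, I_sq]
    ring
  have h2 : (δ : ℂ) * ((0 : ℝ) + t * I) = ((δ * t : ℝ) : ℂ) * I := by push_cast; ring
  rw [kernel, h1, h2, sinhc_mul_I, mul_pow]
  push_cast
  simp
  ring

lemma sinc_pow_integrable {k : ℕ} (hk : 2 ≤ k) : Integrable fun t : ℝ => Real.sinc t ^ k := by
  obtain ⟨M, -, hM⟩ := kernel_exists_bound (m := 0) (k := k) (by omega) one_pos 0 0 0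
  have h := integrable_vertical (differentiable_kernel 0 k 1 0).continuous
    (fun t => hM 0 t le_rfl le_rfl)
  refine h.re.congr (Eventually.of_forall fun t => ?_)
  simp only [kernel_mul_I, pow_zero, one_mul, RCLike.re_eq_complex_re, ofReal_re]

lemma integral_sinc_pow_pos {k : ℕ} (hk : 2 ≤ k) (hk2 : Even k) :
    0 < ∫ t : ℝ, Real.sinc t ^ k := by
  have hnn : ∀ t : ℝ, 0 ≤ Real.sinc t ^ k := fun t => hk2.pow_nonneg _
  rw [integral_pos_iff_support_of_nonneg hnn (sinc_pow_integrable hk)]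
  refine (Continuous.isOpen_support (Real.continuous_sinc.pow k)).measure_pos volume ⟨0, ?_⟩
  simp

/-- The diagonal value of the kernel integral is bounded below. -/
lemma le_norm_integral_kernel {m k : ℕ} (hk : 2 * m + 2 ≤ k) (hk2 : Even k) {δ : ℝ} (hδ : 0 < δ)
    (x : ℝ) :
    δ⁻¹ * ∫ t : ℝ, Real.sinc t ^ k ≤ ‖∫ t : ℝ, kernel m k δ 0 (x + t * I)‖ := by
  rw [integral_kernel_eq hk hδ 0 x 0]
  obtain ⟨M, -, hM⟩ := kernel_exists_bound hk hδ 0 0 0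
  have hint := integrable_vertical (differentiable_kernel m k δ 0).continuous
    (fun t => hM 0 t le_rfl le_rfl)
  have hint2 : Integrable fun t : ℝ => (1 + t ^ 2) ^ m * Real.sinc (δ * t) ^ k := by
    refine hint.norm.congr (Eventually.of_forall fun t => ?_)
    simp only
    rw [kernel_mul_I, norm_mul, norm_pow, norm_neg, norm_one, one_pow, one_mul, norm_real]
    exact Real.norm_of_nonneg (mul_nonneg (by positivity) (hk2.pow_nonneg _))
  simp only [kernel_mul_I]
  rw [integral_const_mul, integral_complex_ofReal, norm_mul, norm_pow, norm_neg, norm_one, one_pow, one_mul,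
    norm_real]
  refine le_trans ?_ (le_abs_self _)
  -- Rescaling by `δ` makes the comparison pointwise, where only `(1 + t²) ^ m ≥ 1` is needed.
  rw [← abs_of_pos (inv_pos.mpr hδ), ← smul_eq_mul,
    ← Measure.integral_comp_mul_left (fun t : ℝ => Real.sinc t ^ k) δ]
  refine integral_mono ((sinc_pow_integrable (by omega)).comp_mul_left' hδ.ne') hint2 fun t => ?_
  exact le_mul_of_one_le_left (hk2.pow_nonneg _) (one_le_pow₀ (by nlinarith [sq_nonneg t]))

end Kernel

/-! ### Phragmén–Lindelöf and extraction of coefficients -/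

/-- In a strip `‖z‖ ≤ 2 * |z.im|` eventually, and a power loses to any exponential. This is the a
priori growth that Phragmén–Lindelöf demands. -/
lemma HasFiniteOrder.isBigO_vertical_strip {E : ℂ → ℂ} (hE : HasFiniteOrder E) (a b : ℝ) {c : ℝ}
    (hc : 0 < c) :
    E =O[comap (_root_.abs ∘ im) atTop ⊓ 𝓟 (re ⁻¹' Set.Ioo a b)]
      fun z => Real.exp (1 * Real.exp (c * |z.im|)) := by
  obtain ⟨ρ, hρ⟩ := hE
  have him : Tendsto (fun z : ℂ => |z.im|)
      (comap (_root_.abs ∘ im) atTop ⊓ 𝓟 (re ⁻¹' Set.Ioo a b)) atTop :=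
    tendsto_comap.mono_left inf_le_left
  have hnorm : Tendsto (fun z : ℂ => z)
      (comap (_root_.abs ∘ im) atTop ⊓ 𝓟 (re ⁻¹' Set.Ioo a b)) (cocompact ℂ) := by
    rw [← Metric.cobounded_eq_cocompact, ← comap_norm_atTop, tendsto_comap_iff]
    exact tendsto_atTop_mono (fun z => abs_im_le_norm z) him
  refine (hρ.comp_tendsto hnorm).trans (IsBigO.of_bound 1 ?_)
  have hlit := (isLittleO_rpow_exp_pos_mul_atTop (max ρ 0) hc).bound
    (show (0 : ℝ) < (2 ^ (max ρ 0))⁻¹ by positivity)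
  filter_upwards [him.eventually hlit, him.eventually (eventually_ge_atTop (max 1 (max |a| |b|))),
    mem_inf_of_right (mem_principal_self _)] with z hz hz1 hz2
  have hre : |z.re| ≤ |z.im| :=
    (abs_le_max_abs_abs hz2.1.le hz2.2.le).trans ((le_max_right _ _).trans hz1)
  have h1 : 1 ≤ |z.im| := (le_max_left _ _).trans hz1
  have h2 : ‖z‖ ≤ 2 * |z.im| := (norm_le_abs_re_add_abs_im z).trans (by linarith)
  have h3 : 1 ≤ ‖z‖ := h1.trans (abs_im_le_norm z)
  rw [Function.comp_apply, Real.norm_of_nonneg (Real.exp_pos _).le,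
    Real.norm_of_nonneg (Real.exp_pos _).le, one_mul, one_mul]
  refine Real.exp_le_exp.mpr ?_
  rw [Real.norm_of_nonneg (by positivity), Real.norm_of_nonneg (Real.exp_pos _).le] at hz
  calc ‖z‖ ^ ρ ≤ ‖z‖ ^ (max ρ 0) := Real.rpow_le_rpow_of_exponent_le h3 (le_max_left _ _)
    _ ≤ (2 * |z.im|) ^ (max ρ 0) := Real.rpow_le_rpow (by linarith) h2 (le_max_right _ _)
    _ = 2 ^ (max ρ 0) * |z.im| ^ (max ρ 0) := Real.mul_rpow zero_le_two (abs_nonneg _)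
    _ ≤ 2 ^ (max ρ 0) * ((2 ^ (max ρ 0))⁻¹ * Real.exp (c * |z.im|)) := by gcongr
    _ = _ := by field_simp

lemma norm_le_four_mul_norm_sub {s : ℂ} (hs : s.re ≤ 2) : ‖s‖ ≤ 4 * ‖s - 3‖ ∧ 1 ≤ ‖s - 3‖ := by
  have h1 : 1 ≤ ‖s - 3‖ := by
    have := abs_re_le_norm (s - 3)
    have h2 : (s - 3).re = s.re - 3 := by simp
    rw [h2, abs_of_neg (by linarith)] at this
    linarith
  have h3 : ‖s‖ ≤ ‖s - 3‖ + ‖(3 : ℂ)‖ := by simpa using norm_add_le (s - 3) 3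
  rw [RCLike.norm_ofNat] at h3
  exact ⟨by linarith, h1⟩

/-- An entire function of finite order with polynomial growth on the two edges of a vertical strip
has polynomial growth inside. -/
lemma HasFiniteOrder.exists_polynomial_bound {E : ℂ → ℂ} (hE : HasFiniteOrder E)
    (hd : Differentiable ℂ E) {a : ℝ} (ha : a < 2) {C : ℝ} (j : ℕ)
    (h2 : ∀ t : ℝ, ‖E ((2 : ℝ) + t * I)‖ ≤ C * ‖((2 : ℝ) + t * I : ℂ) - 3‖ ^ j)
    (h1 : ∀ t : ℝ, ‖E (a + t * I)‖ ≤ C * ‖(a + t * I : ℂ) - 3‖ ^ j)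
    {s : ℂ} (hs1 : a ≤ s.re) (hs2 : s.re ≤ 2) : ‖E s‖ ≤ C * ‖s - 3‖ ^ j := by
  have hpos : ∀ z : ℂ, z.re ≤ 2 → 0 < ‖z - 3‖ ^ j := fun z hz =>
    pow_pos (by linarith [(norm_le_four_mul_norm_sub hz).2]) j
  -- The point `3` lies at distance at least one from the strip, so dividing by `(s - 3) ^ j` turns
  -- polynomial growth into boundedness without creating a pole.
  have key : ‖E s / (s - 3) ^ j‖ ≤ C := by
    refine PhragmenLindelof.vertical_strip (f := fun z => E z / (z - 3) ^ j) (a := a) (b := 2)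
      ?_ ⟨Real.pi / (2 - a) / 2, half_lt_self (div_pos Real.pi_pos (by linarith)), 1, ?_⟩
      ?_ ?_ hs1 hs2
    · refine DifferentiableOn.diffContOnCl fun z hz => ?_
      have hz2 : z.re ≤ 2 := by
        have : closure (re ⁻¹' Set.Ioo a 2) ⊆ re ⁻¹' Set.Iic 2 :=
          closure_minimal (fun w hw => hw.2.le) (isClosed_Iic.preimage continuous_re)
        exact this hz
      have hne : (z - 3) ^ j ≠ 0 := by
        have := hpos z hz2
        rw [← norm_pow] at this
        exact norm_pos_iff.mp this
      exact (hd.differentiableAt.div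
        (show DifferentiableAt ℂ (fun w : ℂ => (w - 3) ^ j) z by fun_prop) hne).differentiableWithinAt
    · refine IsBigO.trans (IsBigO.of_bound 1 ?_) (hE.isBigO_vertical_strip a 2
        (half_pos (div_pos Real.pi_pos (by linarith))))
      filter_upwards [mem_inf_of_right (mem_principal_self _)] with z hz
      rw [norm_div, norm_pow, one_mul]
      exact div_le_self (norm_nonneg _)
        (one_le_pow₀ (norm_le_four_mul_norm_sub (show z.re ≤ 2 from hz.2.le)).2)
    · intro z hz
      have hz' : z = a + z.im * I := by rw [← hz, re_add_im]
      rw [norm_div, norm_pow, div_le_iff₀ (hpos z (by linarith)), hz']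
      exact h1 z.im
    · intro z hz
      have hz' : z = (2 : ℝ) + z.im * I := by rw [← hz, re_add_im]
      rw [norm_div, norm_pow, div_le_iff₀ (hpos z (by linarith)), hz']
      exact h2 z.im
  rwa [norm_div, norm_pow, div_le_iff₀ (hpos s hs2)] at key

/-- Termwise integration of a Dirichlet series against a kernel concentrated at `N`. -/
lemma integral_LSeries_mul_kernel {a : ℕ → ℂ} (ha : LSeriesSummable a 2) {m k : ℕ}
    (hk : 2 * m + 2 ≤ k) {δ : ℝ} (hδ : 0 < δ) {N : ℕ} (hN : 0 < N) (hδN : k * δ * (4 * N) ≤ 1) :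
    ∫ t : ℝ, LSeries a ((2 : ℝ) + t * I) * kernel m k δ (Real.log N) ((2 : ℝ) + t * I)
      = a N * ∫ t : ℝ, kernel m k δ 0 ((2 : ℝ) + t * I) := by
  have hNR : (0 : ℝ) < N := by exact_mod_cast hN
  obtain ⟨M, hM0, hM⟩ := kernel_exists_bound hk hδ (Real.log N) 2 2
  have hKint := integrable_vertical (differentiable_kernel m k δ (Real.log N)).continuous
    (fun t => hM 2 t le_rfl le_rfl)
  have hterm : ∀ n : ℕ, n ≠ 0 → ∀ s : ℂ, LSeries.term a s n * kernel m k δ (Real.log N) s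
      = a n * kernel m k δ (Real.log N - Real.log n) s := by
    intro n hn s
    have hn' : (n : ℂ) ≠ 0 := by exact_mod_cast hn
    rw [LSeries.term_of_ne_zero hn, kernel, kernel, cpow_def_of_ne_zero hn', ← natCast_log,
      ofReal_sub, sub_mul, exp_sub]
    field_simp
  have hnormterm : ∀ n : ℕ, ∀ t : ℝ, ‖LSeries.term a ((2 : ℝ) + t * I) n‖ = ‖LSeries.term a 2 n‖ := by
    intro n t
    simp [LSeries.norm_term_eq]
  have hmeas : ∀ n : ℕ, Continuous fun t : ℝ => LSeries.term a ((2 : ℝ) + t * I) n := by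
    intro n
    rcases eq_or_ne n 0 with rfl | hn
    · simp only [LSeries.term_zero]; exact continuous_const
    · simp only [LSeries.term_of_ne_zero hn]
      have hn' : (n : ℂ) ≠ 0 := by exact_mod_cast hn
      refine continuous_const.div ?_ fun t => by simp [cpow_eq_zero_iff, hn']
      exact (continuous_vertical 2).const_cpow (Or.inl hn')
  have hFint : ∀ n : ℕ, Integrable fun t : ℝ =>
      LSeries.term a ((2 : ℝ) + t * I) n * kernel m k δ (Real.log N) ((2 : ℝ) + t * I) := fun n =>
    hKint.bdd_mul (c := ‖LSeries.term a 2 n‖) (hmeas n).aestronglyMeasurable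
      (Eventually.of_forall fun t => (hnormterm n t).le)
  have hsum := hasSum_integral_of_summable_integral_norm hFint (by
    simp only [norm_mul, hnormterm, integral_const_mul]
    exact ha.norm.mul_right _)
  have hL : ∀ t : ℝ, ∑' n : ℕ, LSeries.term a ((2 : ℝ) + t * I) n *
      kernel m k δ (Real.log N) ((2 : ℝ) + t * I)
      = LSeries a ((2 : ℝ) + t * I) * kernel m k δ (Real.log N) ((2 : ℝ) + t * I) := by
    intro t
    rw [LSeries, tsum_mul_right]
  simp only [hL] at hsum
  refine hsum.unique ?_
  -- For `n ≠ N` the distance from `log n` to `log N` is at least `1 / (2N)`, more than the kernel's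
  -- radius `kδ ≤ 1 / (4N)`.
  have hsingle : ∀ n : ℕ, n ≠ N → ∫ t : ℝ, LSeries.term a ((2 : ℝ) + t * I) n *
      kernel m k δ (Real.log N) ((2 : ℝ) + t * I) = 0 := by
    intro n hn
    rcases eq_or_ne n 0 with rfl | hn0
    · simp
    simp only [hterm n hn0]
    rw [integral_const_mul, integral_kernel_eq_zero hk hδ, mul_zero]
    have hnR : (0 : ℝ) < n := by exact_mod_cast Nat.pos_of_ne_zero hn0
    have h4 : k * δ ≤ 1 / (4 * N) := by rw [le_div_iff₀ (by positivity)]; exact hδN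
    refine h4.trans_lt ?_
    have hN1 : (1 : ℝ) ≤ N := by exact_mod_cast hN
    rcases lt_or_gt_of_ne hn with h | h
    · have h1 : (n : ℝ) + 1 ≤ N := by exact_mod_cast h
      have h5 := Real.log_le_sub_one_of_pos (x := (n : ℝ) / N) (by positivity)
      rw [Real.log_div hnR.ne' hNR.ne'] at h5
      have h6 : (n : ℝ) / N - 1 ≤ -(1 / N) := by
        rw [div_sub_one hNR.ne', ← neg_div]
        gcongr
        linarith
      have h7 : 1 / (4 * N : ℝ) < 1 / N := by gcongr; linarith
      refine lt_of_lt_of_le ?_ (le_abs_self _)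
      linarith
    · have h1 : (N : ℝ) + 1 ≤ n := by exact_mod_cast h
      have h5 := Real.log_le_sub_one_of_pos (x := (N : ℝ) / n) (by positivity)
      rw [Real.log_div hNR.ne' hnR.ne'] at h5
      have h6 : (N : ℝ) / n - 1 ≤ -(1 / (2 * N)) := by
        rw [div_sub_one hnR.ne', ← neg_div, div_le_div_iff₀ hnR (by positivity)]
        nlinarith
      have h7 : 1 / (4 * N : ℝ) < 1 / (2 * N) := by gcongr; linarith
      refine lt_of_lt_of_le ?_ (neg_le_abs _)
      linarith
  have hval : ∫ t : ℝ, LSeries.term a ((2 : ℝ) + t * I) N *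
      kernel m k δ (Real.log N) ((2 : ℝ) + t * I) = a N * ∫ t : ℝ, kernel m k δ 0 ((2 : ℝ) + t * I) := by
    simp only [hterm N hN.ne', sub_self]
    rw [integral_const_mul]
  rw [← hval]
  exact hasSum_single N hsingle

/-- Growth on a line to the left bounds the coefficients of a Dirichlet series. -/
lemma exists_coefficient_bound {k : ℕ} (hk2 : Even k) (hk0 : 2 ≤ k) :
    ∃ A : ℝ, 0 < A ∧ ∀ (m : ℕ) (E F : ℂ → ℂ) (a : ℕ → ℂ) (σ C : ℝ) (N : ℕ), 2 * m + 2 ≤ k →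
      Differentiable ℂ E → HasFiniteOrder E → IsDirichletSeries F a →
      (∀ s : ℂ, s ≠ 1 → E s = (s ^ 2 - 1) ^ m * F s) → 1 ≤ σ → 0 < N →
      (∀ t : ℝ, ‖E ((-σ : ℝ) + t * I)‖ ≤ C * (1 + |t|) ^ (k - 2)) →
      ‖a N‖ ≤ C * A * N ^ (k - 1) * (N * Real.exp (-(1 / (4 * N)))) ^ (-σ) := by
  have hc := integral_sinc_pow_pos hk0 hk2
  set c := ∫ t : ℝ, Real.sinc t ^ k with hcdef
  -- This constant depends on `k` alone; uniformity in `σ` and `N` is what later allows `σ → ∞`.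
  refine ⟨2 ^ k * Real.pi * (4 * k) ^ (k - 1) / c, by positivity, ?_⟩
  intro m E F a σ C N hmk hd hfo hF hEF hσ hN hline
  have hNR : (0 : ℝ) < N := by exact_mod_cast hN
  have hkR : (0 : ℝ) < k := by exact_mod_cast (show 0 < k by omega)
  set δ : ℝ := (4 * k * N)⁻¹ with hδdef
  have hδ : 0 < δ := by positivity
  have hkδ : k * δ = 1 / (4 * N) := by rw [hδdef]; field_simp
  have hC : 0 ≤ C := by
    have := (norm_nonneg _).trans (hline 0)
    simpa using this
  have hsum2 : LSeriesSummable a 2 := (hF 2 (by norm_num)).1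
  set H : ℂ → ℂ := fun s => E s * kernel 0 k δ (Real.log N) s with hH
  have hHd : Differentiable ℂ H := hd.mul (differentiable_kernel _ _ _ _)
  -- polynomial growth of `E` in the strip
  obtain ⟨C', hC'⟩ : ∃ C' : ℝ, 0 ≤ C' ∧ ∀ s : ℂ, -σ ≤ s.re → s.re ≤ 2 →
      ‖E s‖ ≤ C' * ‖s - 3‖ ^ (k - 2) := by
    set B := ∑' n, ‖LSeries.term a (2 : ℝ) n‖
    have hB0 : 0 ≤ B := tsum_nonneg fun _ => norm_nonneg _
    refine ⟨max (C * 2 ^ (k - 2)) (2 ^ m * 4 ^ (2 * m) * B), by positivity, fun s h1 h2 => ?_⟩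
    refine hfo.exists_polynomial_bound hd (a := -σ) (by linarith) (k - 2) (fun t => ?_) (fun t => ?_)
      h1 h2
    · set s : ℂ := (2 : ℝ) + t * I with hs
      have hre : s.re = 2 := by simp [hs]
      have hs1 : 1 ≤ ‖s‖ := by
        have := abs_re_le_norm s
        rw [hre] at this
        norm_num at this
        linarith
      have hne : s ≠ 1 := by rintro h; rw [h] at hre; norm_num at hre
      obtain ⟨h4, h5⟩ := norm_le_four_mul_norm_sub hre.le
      rw [hEF s hne, norm_mul, (hF s (by rw [hre]; norm_num)).2]
      calc _ ≤ (2 ^ m * ‖s‖ ^ (2 * m)) * B := by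
            gcongr
            · exact norm_sq_sub_one_pow_le m hs1
            · exact norm_LSeries_le_of_le_re (by exact_mod_cast hsum2) hre.ge
        _ ≤ (2 ^ m * (4 * ‖s - 3‖) ^ (2 * m)) * B := by gcongr
        _ = (2 ^ m * 4 ^ (2 * m) * B) * ‖s - 3‖ ^ (2 * m) := by ring
        _ ≤ max (C * 2 ^ (k - 2)) (2 ^ m * 4 ^ (2 * m) * B) * ‖s - 3‖ ^ (k - 2) := by
            gcongr
            · exact le_max_right _ _
            · omega
    · refine (hline t).trans ?_
      set s : ℂ := (-σ : ℝ) + t * I with hs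
      have hre : s.re = -σ := by simp [hs]
      have him : (s - 3).im = t := by simp [hs]
      have h5 := (norm_le_four_mul_norm_sub (s := s) (by linarith)).2
      have h6 : |t| ≤ ‖s - 3‖ := by
        rw [← him]
        exact abs_im_le_norm _
      calc C * (1 + |t|) ^ (k - 2) ≤ C * (2 * ‖s - 3‖) ^ (k - 2) := by
            gcongr
            linarith
        _ = (C * 2 ^ (k - 2)) * ‖s - 3‖ ^ (k - 2) := by ring
        _ ≤ _ := by
            gcongr
            exact le_max_left _ _
  -- shift of the contour
  have hshift : ∫ t : ℝ, H ((-σ : ℝ) + t * I) = ∫ t : ℝ, H ((2 : ℝ) + t * I) := by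
    suffices hdec : ∀ s : ℂ, -σ ≤ s.re → s.re ≤ 2 → 1 ≤ ‖s‖ → ‖H s‖ ≤ C' * 4 ^ (k - 2) *
        (δ⁻¹ ^ k * Real.exp ((k * δ + |Real.log N|) * max |(-σ)| |2|)) / ‖s‖ ^ 2 by
      obtain ⟨M, -, hM⟩ := exists_bound_of_decay hHd.continuous hdec
      exact integral_vertical_eq hHd (by linarith) hM
    intro s h1 h2 h3
    have hs0 : s ≠ 0 := norm_pos_iff.mp (by linarith)
    have hre : |s.re| ≤ max |(-σ)| |2| := abs_le_max_abs_abs h1 h2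
    have h3' : ‖s - 3‖ ≤ 4 * ‖s‖ := by
      refine (norm_sub_le _ _).trans ?_
      rw [RCLike.norm_ofNat]
      linarith
    have hexp : Real.exp (k * δ * |s.re|) * Real.exp (Real.log N * s.re)
        ≤ Real.exp ((k * δ + |Real.log N|) * max |(-σ)| |2|) := by
      rw [← Real.exp_add]
      gcongr
      rw [add_mul]
      refine add_le_add (by gcongr) ?_
      calc Real.log N * s.re ≤ |Real.log N * s.re| := le_abs_self _
        _ = |Real.log N| * |s.re| := abs_mul _ _
        _ ≤ _ := by gcongr
    have hk' : ‖s‖ ^ k = ‖s‖ ^ (k - 2) * ‖s‖ ^ 2 := by rw [← pow_add]; congr 1; omega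
    have hspos : 0 < ‖s‖ := by linarith
    calc ‖H s‖ ≤ (C' * ‖s - 3‖ ^ (k - 2)) * (δ⁻¹ ^ k * Real.exp (k * δ * |s.re|) / ‖s‖ ^ k
          * Real.exp (Real.log N * s.re)) := by
          rw [hH, norm_mul, kernel, pow_zero, one_mul, norm_mul, norm_exp, re_ofReal_mul]
          gcongr
          · exact mul_nonneg hC'.1 (by positivity)
          · exact hC'.2 s h1 h2
          · exact norm_sinhc_pow_le hδ k hs0
      _ ≤ (C' * (4 * ‖s‖) ^ (k - 2)) * (δ⁻¹ ^ k * Real.exp (k * δ * |s.re|) / ‖s‖ ^ k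
          * Real.exp (Real.log N * s.re)) := by
          have := hC'.1
          gcongr
      _ = C' * 4 ^ (k - 2) * (δ⁻¹ ^ k * (Real.exp (k * δ * |s.re|) * Real.exp (Real.log N * s.re)))
          / ‖s‖ ^ 2 := by
          rw [hk', mul_pow]
          field_simp
      _ ≤ _ := by
          have := hC'.1
          gcongr
  -- the integral on the right
  have hright : ∫ t : ℝ, H ((2 : ℝ) + t * I) = a N * ∫ t : ℝ, kernel m k δ 0 ((2 : ℝ) + t * I) := by
    rw [← integral_LSeries_mul_kernel hsum2 hmk hδ hN (by rw [hkδ]; field_simp; rfl)]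
    refine integral_congr_ae (Eventually.of_forall fun t => ?_)
    have hre : ((2 : ℝ) + t * I : ℂ).re = 2 := by simp
    have hne : ((2 : ℝ) + t * I : ℂ) ≠ 1 := by
      intro h
      rw [h] at hre
      norm_num at hre
    simp only [hH]
    -- The factor `(s² - 1) ^ m` moves from `E` into the kernel: `E` times the kernel with exponent
    -- `0` is `F` times the kernel with exponent `m`.
    rw [hEF _ hne, (hF _ (by rw [hre]; norm_num)).2, kernel, kernel, pow_zero]
    ring
  -- the integral on the left
  have hleft : ‖∫ t : ℝ, H ((-σ : ℝ) + t * I)‖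
      ≤ C * 2 ^ k * δ⁻¹ ^ k * (N * Real.exp (-(1 / (4 * N)))) ^ (-σ) * Real.pi := by
    refine norm_integral_vertical_le fun t => ?_
    set s : ℂ := (-σ : ℝ) + t * I with hs
    have hre : s.re = -σ := by simp [hs]
    have hsq : ‖s‖ ^ 2 = σ ^ 2 + t ^ 2 := by rw [hs, norm_sq_re_im]; ring
    have hge : 1 + |t| ≤ 2 * ‖s‖ := by
      refine abs_le_of_sq_le_sq' ?_ (by positivity) |>.2
      rw [mul_pow, hsq]
      nlinarith [sq_abs t, sq_nonneg (|t| - 1)]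
    have hs0 : s ≠ 0 := by
      rintro h
      rw [h, norm_zero] at hge
      linarith [abs_nonneg t]
    have hspos : 0 < ‖s‖ := norm_pos_iff.mpr hs0
    have hexp : Real.exp (k * δ * |s.re|) * Real.exp (Real.log N * s.re)
        = (N * Real.exp (-(1 / (4 * N)))) ^ (-σ) := by
      rw [hre, abs_neg, abs_of_pos (by linarith), hkδ, Real.mul_rpow hNR.le (Real.exp_pos _).le,
        ← Real.exp_mul, Real.rpow_def_of_pos hNR, mul_comm]
      congr 2
      ring
    have hk' : (1 + |t|) ^ k = (1 + |t|) ^ (k - 2) * (1 + |t|) ^ 2 := by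
      rw [← pow_add]; congr 1; omega
    have hinv : (1 + |t|) ^ (k - 2) / ‖s‖ ^ k ≤ 2 ^ k * (1 + t ^ 2)⁻¹ := by
      rw [← div_eq_mul_inv, div_le_div_iff₀ (by positivity) (by positivity), ← mul_pow]
      calc (1 + |t|) ^ (k - 2) * (1 + t ^ 2) ≤ (1 + |t|) ^ (k - 2) * (1 + |t|) ^ 2 := by
            gcongr
            nlinarith [sq_abs t, abs_nonneg t]
        _ = (1 + |t|) ^ k := hk'.symm
        _ ≤ _ := by gcongr
    calc ‖H s‖ ≤ (C * (1 + |t|) ^ (k - 2)) * (δ⁻¹ ^ k * Real.exp (k * δ * |s.re|) / ‖s‖ ^ k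
          * Real.exp (Real.log N * s.re)) := by
          rw [hH, norm_mul, kernel, pow_zero, one_mul, norm_mul, norm_exp, re_ofReal_mul]
          gcongr
          · exact hline t
          · exact norm_sinhc_pow_le hδ k hs0
      _ = C * δ⁻¹ ^ k * (Real.exp (k * δ * |s.re|) * Real.exp (Real.log N * s.re))
          * ((1 + |t|) ^ (k - 2) / ‖s‖ ^ k) := by ring
      _ ≤ C * δ⁻¹ ^ k * (Real.exp (k * δ * |s.re|) * Real.exp (Real.log N * s.re))
          * (2 ^ k * (1 + t ^ 2)⁻¹) := by gcongr
      _ = _ := by rw [hexp]; ring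
  rw [hshift, hright, norm_mul] at hleft
  have hlow := le_norm_integral_kernel hmk hk2 hδ 2
  have h1 : ‖a N‖ * (δ⁻¹ * c)
      ≤ C * 2 ^ k * δ⁻¹ ^ k * (N * Real.exp (-(1 / (4 * N)))) ^ (-σ) * Real.pi :=
    (mul_le_mul_of_nonneg_left hlow (norm_nonneg _)).trans hleft
  have hδk : δ⁻¹ ^ k = δ⁻¹ * ((4 * k) ^ (k - 1) * N ^ (k - 1)) := by
    rw [← mul_pow, hδdef, inv_inv, ← pow_succ']
    congr 1
    omega
  rw [hδk] at h1
  have hδc : 0 < δ⁻¹ * c := by positivity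
  refine le_of_mul_le_mul_right (h1.trans (le_of_eq ?_)) hδc
  field_simp

end SelbergClass

/-! ### Degree below one forces degree zero -/

namespace SelbergClass

open Complex Topology

lemma HasFiniteOrder.add_one_mul {E : ℂ → ℂ} (hE : HasFiniteOrder E) :
    HasFiniteOrder fun s => (s + 1) * E s := by
  obtain ⟨ρ, hρ⟩ := hE
  refine ⟨max ρ 1 + 1, ?_⟩
  have h1 : (fun s : ℂ => s + 1) =O[cocompact ℂ] fun s => Real.exp ‖s‖ := by
    refine IsBigO.of_bound 1 (Eventually.of_forall fun s => ?_)
    rw [one_mul, Real.norm_of_nonneg (Real.exp_pos _).le]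
    exact (norm_add_le _ _).trans (by simpa using Real.add_one_le_exp ‖s‖)
  refine (h1.mul hρ).trans (IsBigO.of_bound 1 ?_)
  filter_upwards [(tendsto_norm_cocompact_atTop (E := ℂ)).eventually (eventually_ge_atTop 2)]
    with s hs
  have hs1 : 1 ≤ ‖s‖ := by linarith
  rw [one_mul, ← Real.exp_add, Real.norm_of_nonneg (Real.exp_pos _).le,
    Real.norm_of_nonneg (Real.exp_pos _).le]
  refine Real.exp_le_exp.mpr ?_
  have h2 : ‖s‖ ≤ ‖s‖ ^ (max ρ 1) := by
    conv_lhs => rw [← Real.rpow_one ‖s‖]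
    exact Real.rpow_le_rpow_of_exponent_le hs1 (le_max_right _ _)
  have h3 : ‖s‖ ^ ρ ≤ ‖s‖ ^ (max ρ 1) := Real.rpow_le_rpow_of_exponent_le hs1 (le_max_left _ _)
  rw [Real.rpow_add_one (by linarith)]
  have h4 : 0 ≤ ‖s‖ ^ (max ρ 1) := by positivity
  nlinarith

lemma Analyticity.exists_sq_sub_one {F : ℂ → ℂ} (h : Analyticity F) :
    ∃ (m : ℕ) (E : ℂ → ℂ), Differentiable ℂ E ∧ HasFiniteOrder E ∧
      ∀ s : ℂ, s ≠ 1 → E s = (s ^ 2 - 1) ^ m * F s := by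
  obtain ⟨m, E, hd, hfo, hE⟩ := h
  have key : ∀ n : ℕ, HasFiniteOrder fun s => (s + 1) ^ n * E s := by
    intro n
    induction n with
    | zero => simpa using hfo
    | succ n ih => simpa only [pow_succ', mul_assoc] using ih.add_one_mul
  refine ⟨m, fun s => (s + 1) ^ m * E s, by fun_prop, key m, fun s hs => ?_⟩
  simp only
  rw [hE s hs, ← mul_assoc, ← mul_pow]
  ring

lemma exists_bound_of_isBigO_cocompact {f : ℝ → ℂ} (hf : Continuous f) {e : ℝ} {n : ℕ}
    (hen : e ≤ n) (h : f =O[cocompact ℝ] fun t => |t| ^ e) :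
    ∃ C : ℝ, ∀ t, ‖f t‖ ≤ C * (1 + |t|) ^ n := by
  obtain ⟨C, hC0, hC⟩ := h.exists_pos
  have hev : ∀ᶠ t in cocompact ℝ, ‖f t‖ ≤ C * (1 + |t|) ^ n := by
    filter_upwards [hC.bound, eventually_cocompact_le_abs 1] with t ht h1
    refine ht.trans ?_
    gcongr
    rw [Real.norm_of_nonneg (by positivity), ← Real.rpow_natCast]
    exact (Real.rpow_le_rpow_of_exponent_le h1 hen).trans
      (Real.rpow_le_rpow (abs_nonneg t) (by linarith) (by positivity))
  obtain ⟨K, hK, hKs⟩ := mem_cocompact.mp hev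
  obtain ⟨M, hM⟩ := hK.exists_bound_of_continuousOn hf.continuousOn
  refine ⟨max C M, fun t => ?_⟩
  have h1 : 1 ≤ (1 + |t|) ^ n := one_le_pow₀ (by linarith [abs_nonneg t])
  by_cases ht : t ∈ K
  · refine (hM t ht).trans ((le_max_right C M).trans ?_)
    exact le_mul_of_one_le_right (hC0.le.trans (le_max_left _ _)) h1
  · refine (hKs ht).trans ?_
    gcongr
    exact le_max_left _ _

/-- In degree less than one the coefficients decay faster than any power. -/
lemma exists_coefficient_decay {F : ℂ → ℂ} {a : ℕ → ℂ} {γ : GammaFactor}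
    (hF : IsDirichletSeries F a) (hA : Analyticity F) (hγ : FunctionalEquation F γ)
    (hE : EulerProduct F a) (hdeg : γ.degree < 1) (M : ℕ) :
    ∃ C : ℝ, ∀ n ≠ 0, ‖a n‖ ≤ C * (n : ℝ) ^ (-(M : ℝ)) := by
  obtain ⟨m, E, hd, hfo, hEF⟩ := hA.exists_sq_sub_one
  have hd1 : 0 < 1 - γ.degree := sub_pos.mpr hdeg
  -- With `k = 2j` and `σ = k - 1 + M`, the growth exponent `2m + γ.degree * (σ + 1/2) + γ.k` must
  -- be at most `k - 2`. Its slope in `k` is `γ.degree < 1`, so a large `j` suffices. This `σ` turns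
  -- `n ^ (k - 1 - σ)` into `n ^ (-M)`.
  obtain ⟨j, hj⟩ := exists_nat_gt
    (max (2 * m + 2 : ℝ) ((γ.degree * M + γ.k + 2 * m + 2) / (1 - γ.degree)))
  have hj1 : 2 * m + 2 ≤ j := by exact_mod_cast ((le_max_left _ _).trans_lt hj).le
  have hj2 : γ.degree * M + γ.k + 2 * m + 2 ≤ j * (1 - γ.degree) := by
    rw [← div_le_iff₀ hd1]
    exact ((le_max_right _ _).trans_lt hj).le
  set k := 2 * j with hk
  have hkj : (k : ℝ) = 2 * j := by rw [hk]; push_cast; ring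
  set σ : ℝ := k - 1 + M with hσ
  have hj3 : (2 : ℝ) ≤ j := by exact_mod_cast (show 2 ≤ j by omega)
  have hσ1 : 1 ≤ σ := by
    rw [hσ, hkj]
    have : (0 : ℝ) ≤ M := Nat.cast_nonneg M
    linarith
  have hσ0 : 0 < σ := by linarith
  obtain ⟨A, hA0, hcoef⟩ := exists_coefficient_bound (k := k) (even_two_mul j) (by omega)
  obtain ⟨C, hC⟩ : ∃ C : ℝ, ∀ t : ℝ, ‖E ((-σ : ℝ) + t * I)‖ ≤ C * (1 + |t|) ^ (k - 2) := by
    have hpoly : (fun t : ℝ => (((-σ : ℝ) + t * I : ℂ) ^ 2 - 1) ^ m) =O[cocompact ℝ]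
        fun t : ℝ => |t| ^ ((2 * m : ℕ) : ℝ) := by
      refine IsBigO.of_bound (2 ^ m * (σ + 1) ^ (2 * m)) ?_
      filter_upwards [eventually_cocompact_le_abs 1] with t ht
      have h1 : 1 ≤ ‖((-σ : ℝ) + t * I : ℂ)‖ := by
        refine ht.trans ?_
        simpa using abs_im_le_norm ((-σ : ℝ) + t * I : ℂ)
      have h2 : ‖((-σ : ℝ) + t * I : ℂ)‖ ≤ (σ + 1) * |t| := by
        refine (norm_add_le _ _).trans ?_
        rw [norm_real, norm_mul, norm_I, norm_real, Real.norm_eq_abs, Real.norm_eq_abs, abs_neg,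
          abs_of_pos hσ0]
        nlinarith
      refine (norm_sq_sub_one_pow_le m h1).trans ?_
      rw [Real.rpow_natCast, norm_pow, Real.norm_eq_abs, abs_abs, mul_assoc, ← mul_pow]
      gcongr
    refine exists_bound_of_isBigO_cocompact (hd.continuous.comp (continuous_vertical _))
      (e := (2 * m : ℕ) + (γ.degree * (σ + 1 / 2) + γ.k)) ?_ ?_
    · rw [Nat.cast_sub (by omega)]
      push_cast
      rw [hσ, hkj]
      nlinarith [γ.degree_nonneg]
    · refine (IsBigO.congr' (hpoly.mul (isBigO_on_left_line hE hγ hσ0)) ?_ ?_)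
      · filter_upwards [eventually_cocompact_le_abs 1] with t ht
        refine (hEF _ fun h => ?_).symm
        have := congrArg re h
        simp at this
        linarith
      · filter_upwards [eventually_cocompact_le_abs 1] with t ht
        exact (Real.rpow_add (by linarith) _ _).symm
  have hC0 : 0 ≤ C := by simpa using (norm_nonneg _).trans (hC 0)
  refine ⟨C * A * Real.exp (σ / 4), fun n hn => ?_⟩
  have hn0 : 0 < n := Nat.pos_of_ne_zero hn
  have hnR : (0 : ℝ) < n := by exact_mod_cast hn0
  have hn1 : (1 : ℝ) ≤ n := by exact_mod_cast hn0
  refine (hcoef m E F a σ C n (by omega) hd hfo hF hEF hσ1 hn0 hC).trans ?_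
  rw [Real.mul_rpow hnR.le (Real.exp_pos _).le, ← Real.exp_mul]
  have h1 : -(1 / (4 * n : ℝ)) * -σ ≤ σ / 4 := by
    rw [neg_mul_neg, div_mul_eq_mul_div, one_mul, div_le_div_iff₀ (by positivity) (by norm_num)]
    nlinarith
  have h2 : (n : ℝ) ^ (k - 1) * (n : ℝ) ^ (-σ) = (n : ℝ) ^ (-(M : ℝ)) := by
    rw [← Real.rpow_natCast, ← Real.rpow_add hnR, Nat.cast_sub (by omega), hσ]
    congr 1
    push_cast
    ring
  calc _ = C * A * Real.exp (-(1 / (4 * n : ℝ)) * -σ) * ((n : ℝ) ^ (k - 1) * (n : ℝ) ^ (-σ)) := by ring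
    _ ≤ C * A * Real.exp (σ / 4) * ((n : ℝ) ^ (k - 1) * (n : ℝ) ^ (-σ)) := by gcongr
    _ = _ := by rw [h2]

section SmallDegree

variable {F : ℂ → ℂ} {a : ℕ → ℂ} {γ : GammaFactor}

lemma abscissaOfAbsConv_eq_bot (hF : IsDirichletSeries F a) (hA : Analyticity F)
    (hγ : FunctionalEquation F γ) (hE : EulerProduct F a) (hdeg : γ.degree < 1) :
    LSeries.abscissaOfAbsConv a = ⊥ := by
  rw [EReal.eq_bot_iff_forall_lt]
  intro y
  obtain ⟨M, hM⟩ := exists_nat_gt (1 - y)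
  have := LSeries.abscissaOfAbsConv_le_of_le_const_mul_rpow
    (exists_coefficient_decay hF hA hγ hE hdeg M)
  refine this.trans_lt ?_
  exact_mod_cast (show -(M : ℝ) + 1 < y by linarith)

lemma differentiable_LSeries (ha : LSeries.abscissaOfAbsConv a = ⊥) :
    Differentiable ℂ (LSeries a) := fun s =>
  (LSeries_hasDerivAt (by rw [ha]; exact EReal.bot_lt_coe _)).differentiableAt

lemma eqOn_LSeries (hF : IsDirichletSeries F a) (hA : Analyticity F)
    (ha : LSeries.abscissaOfAbsConv a = ⊥) : Set.EqOn F (LSeries a) {1}ᶜ := by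
  obtain ⟨m, E, hd, -, hEF⟩ := hA
  have hL := differentiable_LSeries ha
  have heq : E = fun s => (s - 1) ^ m * LSeries a s := by
    refine AnalyticOnNhd.eq_of_eventuallyEq (z₀ := 2)
      (hd.differentiableOn.analyticOnNhd isOpen_univ)
      (DifferentiableOn.analyticOnNhd (Differentiable.differentiableOn (by fun_prop)) isOpen_univ) ?_
    have : ∀ᶠ s : ℂ in 𝓝 2, 1 < s.re :=
      continuous_re.continuousAt.eventually (lt_mem_nhds (by norm_num))
    filter_upwards [this] with s hs
    rw [hEF s (by rintro rfl; simp at hs), (hF s hs).2]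
  intro s hs
  have h1 := hEF s hs
  rw [heq] at h1
  exact (mul_left_cancel₀ (pow_ne_zero m (sub_ne_zero.mpr hs)) h1).symm

/-- An everywhere absolutely convergent series is bounded on each line `Re s = -σ`, yet `F` is at
least of order `|t| ^ (γ.degree * (σ + 1/2) - γ.k)` there; let `σ → ∞`. -/
lemma degree_eq_zero (hF : IsDirichletSeries F a) (hA : Analyticity F)
    (hγ : FunctionalEquation F γ) (hE : EulerProduct F a) (hdeg : γ.degree < 1) :
    γ.degree ≤ 0 := by
  have ha := abscissaOfAbsConv_eq_bot hF hA hγ hE hdeg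
  refine le_of_forall_mul_add_le (K := γ.k) fun σ hσ => ?_
  have hbd : (fun t : ℝ => F ((-σ : ℝ) + t * I)) =O[cocompact ℝ] fun t : ℝ => |t| ^ (0 : ℝ) := by
    refine IsBigO.of_bound (∑' n, ‖LSeries.term a (-σ : ℝ) n‖) (Eventually.of_forall fun t => ?_)
    rw [eqOn_LSeries hF hA ha (x := (-σ : ℝ) + t * I)]
    · simpa using norm_LSeries_le_of_le_re (b := a) (c := -σ) (s := (-σ : ℝ) + t * I)
        (LSeriesSummable_of_abscissaOfAbsConv_lt_re (by rw [ha]; exact EReal.bot_lt_coe _))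
        (by simp)
    · intro h
      have := congrArg re (Set.mem_singleton_iff.mp h)
      simp at this
      linarith
  have := le_of_rpow_isBigO_rpow ((isBigO_left_line hE hγ (by linarith)).trans hbd)
  nlinarith [γ.degree_nonneg]

end SmallDegree

end SelbergClass

/-! ### Degree zero: the Euler product of a Dirichlet polynomial -/

namespace SelbergClass

open Complex Topology

section LogDerivative

variable {a b : ℕ → ℂ}

/-- Taking the logarithmic derivative of `∑ a n n ^ (-s) = exp (∑ b n n ^ (-s))`. -/
lemma logMul_eq_convolution
    (h : ∀ s : ℂ, 1 < s.re → LSeriesSummable a s ∧ LSeriesSummable b s ∧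
      LSeries a s = exp (LSeries b s)) {n : ℕ} (hn : n ≠ 0) :
    LSeries.logMul a n = LSeries.convolution a (LSeries.logMul b) n := by
  have hle : ∀ c : ℕ → ℂ, (∀ s : ℂ, 1 < s.re → LSeriesSummable c s) →
      LSeries.abscissaOfAbsConv c ≤ (1 : ℝ) := fun c hc =>
    LSeries.abscissaOfAbsConv_le_of_forall_lt_LSeriesSummable fun y hy => hc y (by simpa using hy)
  have ha1 := hle a fun s hs => (h s hs).1
  have hb1 := hle b fun s hs => (h s hs).2.1
  have hlt : ∀ s : ℂ, 1 < s.re → ∀ c : ℕ → ℂ, LSeries.abscissaOfAbsConv c ≤ (1 : ℝ) →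
      LSeries.abscissaOfAbsConv c < s.re := fun s hs c hc =>
    hc.trans_lt (by exact_mod_cast hs)
  have hsumm : ∀ s : ℂ, 1 < s.re →
      LSeriesSummable (LSeries.convolution a (LSeries.logMul b)) s := fun s hs =>
    (h s hs).1.convolution (LSeriesSummable_logMul_of_lt_re (hlt s hs b hb1))
  refine LSeries.eq_of_LSeries_eventually_eq
    (by rw [LSeries.abscissaOfAbsConv_logMul]; exact ha1.trans_lt (EReal.coe_lt_top 1))
    ((hle _ hsumm).trans_lt (EReal.coe_lt_top 1)) ?_ hn
  filter_upwards [eventually_gt_atTop 1] with x hx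
  have hx' : 1 < (x : ℂ).re := by simpa using hx
  rw [LSeries_convolution' (h x hx').1 (LSeriesSummable_logMul_of_lt_re (hlt x hx' b hb1))]
  have hda := LSeries_hasDerivAt (hlt x hx' a ha1)
  have hdb := (LSeries_hasDerivAt (hlt x hx' b hb1)).cexp
  have hev : LSeries a =ᶠ[𝓝 (x : ℂ)] fun s => exp (LSeries b s) := by
    have : ∀ᶠ s : ℂ in 𝓝 (x : ℂ), 1 < s.re :=
      continuous_re.continuousAt.eventually (lt_mem_nhds hx')
    filter_upwards [this] with s hs using (h s hs).2.2
  have := hda.unique (hdb.congr_of_eventuallyEq hev)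
  rw [← (h x hx').2.2] at this
  linear_combination -this

/-- If `a` has finite support then `b` is supported on prime powers of finitely many primes. -/
lemma eq_zero_of_prime_pow
    (h : ∀ s : ℂ, 1 < s.re → LSeriesSummable a s ∧ LSeriesSummable b s ∧
      LSeries a s = exp (LSeries b s)) (ha1 : a 1 = 1) {N : ℕ} (hN : ∀ n, N < n → a n = 0)
    {p j : ℕ} (hp : p.Prime) (hpN : N < p) (hj : j ≠ 0) : b (p ^ j) = 0 := by
  have hn : p ^ j ≠ 0 := pow_ne_zero _ hp.ne_zero
  have hgt : N < p ^ j := hpN.trans_le (Nat.le_self_pow hj p)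
  have h1 := logMul_eq_convolution h hn
  rw [LSeries.logMul, hN _ hgt, mul_zero, LSeries.convolution_def] at h1
  beta_reduce at h1
  -- Every divisor `p ^ i` with `i ≥ 1` exceeds `N`, so only the term with `a 1 = 1` survives.
  rw [Finset.sum_eq_single ((1, p ^ j) : ℕ × ℕ)] at h1
  · rw [ha1, one_mul, LSeries.logMul] at h1
    refine (mul_eq_zero.mp h1.symm).resolve_left ?_
    rw [← natCast_log]
    refine ofReal_ne_zero.mpr (Real.log_pos ?_).ne'
    exact_mod_cast Nat.one_lt_pow hj hp.one_lt
  · rintro ⟨x, y⟩ hxy hne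
    rw [Nat.mem_divisorsAntidiagonal] at hxy
    obtain ⟨i, -, rfl⟩ := (Nat.dvd_prime_pow hp).mp ⟨y, hxy.1.symm⟩
    rcases eq_or_ne i 0 with rfl | hi
    · refine absurd ?_ hne
      simpa using hxy.1
    · simp only
      rw [hN _ (hpN.trans_le (Nat.le_self_pow hi p)), zero_mul]
  · intro hnot
    exact absurd (Nat.mem_divisorsAntidiagonal.mpr ⟨one_mul _, hn⟩) hnot

end LogDerivative

/-- A sequence of size `n ^ θ`, supported on smooth numbers, has a Dirichlet series converging for
`Re s > θ`. -/
lemma LSeriesSummable_of_smooth {b : ℕ → ℂ} {θ : ℝ} {N : ℕ} {s : ℂ} (hs : θ < s.re)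
    (hb : b =O[atTop] fun n : ℕ => (n : ℝ) ^ θ)
    (hsupp : ∀ n, n ∉ N.smoothNumbers → b n = 0) : LSeriesSummable b s := by
  have hpos : 0 < s.re - θ := sub_pos.mpr hs
  -- This completely multiplicative function dominates the terms up to a constant. Its sum over
  -- smooth numbers is a finite product of geometric series.
  let f : ℕ →* ℝ :=
    { toFun := fun n => (n : ℝ) ^ (-(s.re - θ))
      map_one' := by simp
      map_mul' := fun m n => by
        push_cast
        exact Real.mul_rpow (Nat.cast_nonneg m) (Nat.cast_nonneg n) }
  have hf : ∀ {p : ℕ}, p.Prime → ‖f p‖ < 1 := by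
    intro p hp
    have hp1 : (1 : ℝ) < p := by exact_mod_cast hp.one_lt
    change ‖(p : ℝ) ^ (-(s.re - θ))‖ < 1
    rw [Real.norm_of_nonneg (by positivity)]
    exact Real.rpow_lt_one_of_one_lt_of_neg hp1 (by linarith)
  have h1 := (EulerProduct.summable_and_hasSum_smoothNumbers_prod_primesBelow_geometric hf N).1
  have h2 : Summable (Set.indicator (N.smoothNumbers : Set ℕ) fun n : ℕ => ‖f n‖) :=
    summable_subtype_iff_indicator.mp h1
  obtain ⟨C, hC0, hC⟩ := hb.exists_pos
  refine summable_of_isBigO_nat h2 (IsBigO.of_bound C ?_)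
  filter_upwards [hC.bound, eventually_gt_atTop 0] with n hn hn0
  have hnR : (0 : ℝ) < n := by exact_mod_cast hn0
  by_cases hmem : n ∈ N.smoothNumbers
  · rw [Set.indicator_of_mem hmem, norm_norm, LSeries.norm_term_eq, if_neg hn0.ne']
    change _ ≤ C * ‖(n : ℝ) ^ (-(s.re - θ))‖
    rw [Real.norm_of_nonneg (by positivity)] at hn ⊢
    rw [div_le_iff₀ (by positivity), mul_assoc, ← Real.rpow_add hnR]
    refine hn.trans (le_of_eq ?_)
    congr 2
    ring
  · rw [Set.indicator_of_notMem hmem, LSeries.norm_term_eq, if_neg hn0.ne', hsupp n hmem]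
    simp

/-! ### Degree zero: only the constant function -/

section DegreeZero

variable {F : ℂ → ℂ} {a : ℕ → ℂ} {γ : GammaFactor}

lemma FunctionalEquation.norm_eq_of_k_eq_zero (h : FunctionalEquation F γ) (hk : γ.k = 0) {s : ℂ}
    (h0 : s ≠ 0) (h1 : s ≠ 1) :
    ‖F s‖ = γ.Q ^ (1 - 2 * s.re) * ‖F (1 - star s)‖ := by
  have hE : IsEmpty (Fin γ.k) := by rw [hk]; infer_instance
  have heval : ∀ z : ℂ, ‖γ.eval z‖ = γ.Q ^ z.re := fun z => by
    rw [GammaFactor.eval, Finset.univ_eq_empty, Finset.prod_empty, mul_one, norm_mul, γ.norm_ε,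
      one_mul, norm_cpow_eq_rpow_re_of_pos γ.Q_pos]
  have := congrArg norm (h s h0 h1 (fun i => hE.elim i) (fun i => hE.elim i))
  rw [norm_star, norm_mul, norm_mul, heval, heval] at this
  have hQ : 0 < γ.Q ^ s.re := Real.rpow_pos_of_pos γ.Q_pos _
  refine mul_left_cancel₀ hQ.ne' (this.trans ?_)
  rw [← mul_assoc, ← Real.rpow_add γ.Q_pos]
  congr 2
  simp
  ring

/-- In degree zero the Dirichlet series is a Dirichlet polynomial. -/
lemma exists_support_bound (hF : IsDirichletSeries F a) (hA : Analyticity F)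
    (hγ : FunctionalEquation F γ) (hE : EulerProduct F a) (hk : γ.k = 0) :
    ∃ N : ℕ, ∀ n, N < n → a n = 0 := by
  obtain ⟨m, E, hd, hfo, hEF⟩ := hA.exists_sq_sub_one
  obtain ⟨B, hB⟩ := hE.norm_bounds (c := 2) (by norm_num)
  obtain ⟨A, hA0, hcoef⟩ := exists_coefficient_bound (k := 2 * (m + 1)) (even_two_mul _) (by omega)
  have hQ := γ.Q_pos
  -- The factor `2` absorbs `exp(-1 / (4n)) ≥ 1/2`, so that `n > N` gives `R > Q²`.
  obtain ⟨N, hN⟩ := exists_nat_gt (2 * γ.Q ^ 2)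
  refine ⟨N, fun n hn => ?_⟩
  have hn0 : 0 < n := by omega
  have hn1 : (1 : ℝ) ≤ n := by exact_mod_cast hn0
  have hnR : (0 : ℝ) < n := by linarith
  set R : ℝ := n * Real.exp (-(1 / (4 * n))) with hR
  have hRpos : 0 < R := by positivity
  have hRQ : γ.Q ^ 2 < R := by
    have h1 : (2 : ℝ)⁻¹ ≤ Real.exp (-(1 / (4 * n))) := by
      have h2 := Real.add_one_le_exp (-(1 / (4 * n : ℝ)))
      have h3 : 1 / (4 * n : ℝ) ≤ 1 / 4 := by gcongr; linarith
      linarith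
    have h4 : (N : ℝ) < n := by exact_mod_cast hn
    calc γ.Q ^ 2 < n * 2⁻¹ := by linarith
      _ ≤ R := by rw [hR]; gcongr
  set r : ℝ := γ.Q ^ 2 / R with hr
  have hr0 : 0 < r := by positivity
  have hr1 : r < 1 := by rw [hr, div_lt_one hRpos]; exact hRQ
  -- The coefficient bound on the line `Re s = -j`: a polynomial in `j` times `r ^ j` with `r < 1`,
  -- so `j → ∞` gives `a n = 0`.
  have hbd : ∀ j : ℕ, 1 ≤ j → ‖a n‖ ≤ (Real.exp B * γ.Q * A * n ^ (2 * (m + 1) - 1) * 2 ^ (2 * m))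
      * ((j : ℝ) ^ (2 * m) * r ^ j) := by
    intro j hj
    have hj1 : (1 : ℝ) ≤ j := by exact_mod_cast hj
    have hline : ∀ t : ℝ, ‖E ((-(j : ℝ) : ℝ) + t * I)‖
        ≤ ((1 + j : ℝ) ^ (2 * m) * γ.Q ^ (1 + 2 * (j : ℝ)) * Real.exp B)
          * (1 + |t|) ^ (2 * (m + 1) - 2) := by
      intro t
      set s : ℂ := (-(j : ℝ) : ℝ) + t * I with hs
      have hre : s.re = -(j : ℝ) := by simp [hs]
      have hs0 : s ≠ 0 := by rintro h; rw [h, zero_re] at hre; linarith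
      have hs1 : s ≠ 1 := by rintro h; rw [h, one_re] at hre; linarith
      have h1 : ‖s ^ 2 - 1‖ ≤ ((1 + j) * (1 + |t|)) ^ 2 := by
        refine (norm_sub_le _ _).trans ?_
        rw [norm_pow, norm_one, hs, norm_sq_re_im]
        nlinarith [abs_nonneg t, sq_abs t, mul_nonneg (Nat.cast_nonneg (α := ℝ) j) (abs_nonneg t)]
      have h2 : ‖F s‖ ≤ γ.Q ^ (1 + 2 * (j : ℝ)) * Real.exp B := by
        rw [hγ.norm_eq_of_k_eq_zero hk hs0 hs1, hre, mul_neg, sub_neg_eq_add]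
        gcongr
        exact (hB _ (by simp [hre]; linarith)).2
      rw [hEF s hs1, norm_mul, norm_pow]
      calc _ ≤ (((1 + j) * (1 + |t|)) ^ 2) ^ m * (γ.Q ^ (1 + 2 * (j : ℝ)) * Real.exp B) := by gcongr
        _ = _ := by
          rw [show 2 * (m + 1) - 2 = 2 * m by omega, ← pow_mul, mul_pow]
          ring
    refine (hcoef m E F a j _ n (by omega) hd hfo hF hEF hj1 hn0 hline).trans ?_
    have h3 : γ.Q ^ (1 + 2 * (j : ℝ)) = γ.Q * (γ.Q ^ 2) ^ j := by
      rw [Real.rpow_add hQ, Real.rpow_one, ← pow_mul, ← Real.rpow_natCast]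
      push_cast
      rfl
    have h4 : (1 + j : ℝ) ^ (2 * m) ≤ (2 * j) ^ (2 * m) := by
      gcongr
      linarith
    rw [h3, Real.rpow_neg hRpos.le, Real.rpow_natCast]
    calc _ ≤ (2 * j : ℝ) ^ (2 * m) * (γ.Q * (γ.Q ^ 2) ^ j) * Real.exp B * A
          * n ^ (2 * (m + 1) - 1) * (R ^ j)⁻¹ := by gcongr
      _ = _ := by
        rw [hr, div_pow, mul_pow]
        ring
  have hlim := (tendsto_pow_const_mul_const_pow_of_abs_lt_one (2 * m)
    (r := r) (by rwa [abs_of_pos hr0])).const_mul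
    (Real.exp B * γ.Q * A * n ^ (2 * (m + 1) - 1) * 2 ^ (2 * m))
  rw [mul_zero] at hlim
  have := ge_of_tendsto hlim (by filter_upwards [eventually_ge_atTop 1] with j hj using hbd j hj)
  exact norm_eq_zero.mp (le_antisymm this (norm_nonneg _))

/-- Finite support of `a` confines `b` to powers of primes at most `N`, so its series converges for
`Re s > θ` and the identity with `exp` continues there. The condition `θ < 1/2` is what brings in
the line `Re s = 1/2`. -/
lemma exists_norm_bounds_half (hF : IsDirichletSeries F a) (hE : EulerProduct F a)
    (hL : Differentiable ℂ (LSeries a)) {N : ℕ} (hN : ∀ n, N < n → a n = 0) :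
    ∃ B : ℝ, ∀ s : ℂ, 1 / 2 ≤ s.re →
      Real.exp (-B) ≤ ‖LSeries a s‖ ∧ ‖LSeries a s‖ ≤ Real.exp B := by
  obtain ⟨ha1, b, hb, hpp, θ, hθ, hbθ⟩ := hE
  have hab : ∀ s : ℂ, 1 < s.re → LSeriesSummable a s ∧ LSeriesSummable b s ∧
      LSeries a s = exp (LSeries b s) := fun s hs =>
    ⟨(hF s hs).1, (hb s hs).1, by rw [← (hF s hs).2, (hb s hs).2]⟩
  have hsupp : ∀ n, n ∉ (N + 1).smoothNumbers → b n = 0 := by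
    intro n hn
    by_cases hnpp : IsPrimePow n
    · obtain ⟨p, j, hp, hj, rfl⟩ := hnpp
      rw [← Nat.prime_iff] at hp
      refine eq_zero_of_prime_pow hab ha1 hN hp ?_ hj.ne'
      by_contra! hle
      refine hn ?_
      rw [Nat.mem_smoothNumbers']
      intro q hq hqd
      rw [(Nat.prime_dvd_prime_iff_eq hq hp).mp (hq.dvd_of_dvd_pow hqd)]
      omega
    · exact hpp n hnpp
  have hsum : ∀ s : ℂ, θ < s.re → LSeriesSummable b s := fun s hs =>
    LSeriesSummable_of_smooth hs hbθ hsupp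
  have habs : LSeries.abscissaOfAbsConv b ≤ θ :=
    LSeries.abscissaOfAbsConv_le_of_forall_lt_LSeriesSummable fun y hy => hsum y (by simpa using hy)
  have heq : Set.EqOn (LSeries a) (fun s => exp (LSeries b s)) {s | θ < s.re} := by
    have hopen : IsOpen {s : ℂ | θ < s.re} := isOpen_lt continuous_const continuous_re
    refine AnalyticOnNhd.eqOn_of_preconnected_of_eventuallyEq (z₀ := 2)
      (hL.differentiableOn.analyticOnNhd hopen)
      (DifferentiableOn.analyticOnNhd (fun s hs => ?_) hopen)
      (convex_halfSpace_re_gt θ).isPreconnected (show θ < (2 : ℂ).re by norm_num; linarith) ?_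
    · have hlt : LSeries.abscissaOfAbsConv b < s.re := habs.trans_lt (by exact_mod_cast hs)
      exact (LSeries_hasDerivAt hlt).differentiableAt.cexp.differentiableWithinAt
    · have : ∀ᶠ s : ℂ in 𝓝 2, 1 < s.re :=
        continuous_re.continuousAt.eventually (lt_mem_nhds (by norm_num))
      filter_upwards [this] with s hs using (hab s hs).2.2
  refine ⟨∑' n, ‖LSeries.term b (1 / 2 : ℝ) n‖, fun s hs => ?_⟩
  rw [heq (show θ < s.re by linarith)]
  exact exp_neg_le_norm_exp (norm_LSeries_le_of_le_re
    (hsum _ (show θ < ((1 / 2 : ℝ) : ℂ).re by rw [ofReal_re]; exact hθ)) hs)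

/-- The only member of degree less than one is the constant function `1`. -/
theorem eqOn_one_of_degree_lt_one (hF : IsDirichletSeries F a) (hA : Analyticity F)
    (hγ : FunctionalEquation F γ) (hE : EulerProduct F a) (hdeg : γ.degree < 1) :
    Set.EqOn F 1 {1}ᶜ := by
  have ha := abscissaOfAbsConv_eq_bot hF hA hγ hE hdeg
  have hk := γ.k_eq_zero_of_degree_le_zero (degree_eq_zero hF hA hγ hE hdeg)
  have hFL := eqOn_LSeries hF hA ha
  have hL := differentiable_LSeries ha
  obtain ⟨N, hN⟩ := exists_support_bound hF hA hγ hE hk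
  obtain ⟨B, hB⟩ := exists_norm_bounds_half hF hE hL hN
  have hfe : ∀ s : ℂ, s ∈ ({0, 1} : Set ℂ)ᶜ →
      ‖LSeries a s‖ = γ.Q ^ (1 - 2 * s.re) * ‖LSeries a (1 - star s)‖ := by
    intro s hs
    simp only [Set.mem_compl_iff, Set.mem_insert_iff, Set.mem_singleton_iff, not_or] at hs
    rw [← hFL hs.2, ← hFL, hγ.norm_eq_of_k_eq_zero hk hs.1 hs.2]
    intro h
    refine hs.1 (star_eq_zero.mp ?_)
    have h' : 1 - star s = 1 := h
    linear_combination -h'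
  -- The functional equation is unavailable at `0` and `1`; closed bounds extend there by
  -- continuity.
  have hdense : Dense ({0, 1} : Set ℂ)ᶜ := (Set.toFinite _).countable.dense_compl ℝ
  have hextend : ∀ P : Set ℝ, IsClosed P →
      (∀ s ∈ ({0, 1} : Set ℂ)ᶜ, ‖LSeries a s‖ ∈ P) → ∀ s, ‖LSeries a s‖ ∈ P := by
    intro P hP h s
    have hcl : IsClosed {s : ℂ | ‖LSeries a s‖ ∈ P} := hP.preimage hL.continuous.norm
    exact (hcl.closure_subset_iff.mpr h) (hdense s)
  have hre : ∀ s : ℂ, s.re ≤ 1 / 2 → 1 / 2 ≤ (1 - star s).re := by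
    intro s hs
    simp
    linarith
  have hconst : ∀ z w : ℂ, LSeries a z = LSeries a w := by
    -- For `Re s ≤ 1/2` the factor `Q ^ (1 - 2 Re s)` is at most one if `Q ≤ 1`, preserving the
    -- upper bound. If `Q ≥ 1` it is at least one, preserving the lower bound, and Liouville applies
    -- to the inverse.
    rcases le_total γ.Q 1 with hQ | hQ
    · have hle := hextend (Set.Iic (Real.exp B)) isClosed_Iic fun s hs => by
        rcases le_total (1 / 2) s.re with h | h
        · exact (hB s h).2
        · rw [Set.mem_Iic, hfe s hs]
          refine (mul_le_of_le_one_left (norm_nonneg _) ?_).trans (hB _ (hre s h)).2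
          exact Real.rpow_le_one γ.Q_pos.le hQ (by linarith)
      refine fun z w => hL.apply_eq_apply_of_bounded ?_ z w
      refine isBounded_iff_forall_norm_le.mpr ⟨Real.exp B, ?_⟩
      rintro _ ⟨s, rfl⟩
      exact hle s
    · have hge := hextend (Set.Ici (Real.exp (-B))) isClosed_Ici fun s hs => by
        rcases le_total (1 / 2) s.re with h | h
        · exact (hB s h).1
        · rw [Set.mem_Ici, hfe s hs]
          refine (hB _ (hre s h)).1.trans (le_mul_of_one_le_left (norm_nonneg _) ?_)
          exact Real.one_le_rpow hQ (by linarith)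
      have hne : ∀ s, LSeries a s ≠ 0 := fun s =>
        norm_pos_iff.mp ((Real.exp_pos _).trans_le (hge s))
      have hinv : Differentiable ℂ fun s => (LSeries a s)⁻¹ := hL.inv hne
      intro z w
      refine inv_injective (hinv.apply_eq_apply_of_bounded ?_ z w)
      refine isBounded_iff_forall_norm_le.mpr ⟨(Real.exp (-B))⁻¹, ?_⟩
      rintro _ ⟨s, rfl⟩
      simp only [norm_inv]
      exact inv_anti₀ (Real.exp_pos _) (hge s)
  -- The constant is the limit at `+∞`, namely `a 1 = 1`.
  have hlim := LSeries.tendsto_atTop (f := a) (by rw [ha]; exact bot_lt_top)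
  intro s hs
  rw [hFL hs, Pi.one_apply, ← hE.1]
  refine tendsto_nhds_unique ?_ hlim
  exact tendsto_const_nhds.congr fun x => hconst s x

end DegreeZero

/-! ### Induction on the degree -/

/-- Factorization into primitive members, by induction on a bound for the degree. -/
theorem exists_factorization (n : ℕ) : ∀ (F : ℂ → ℂ) (a : ℕ → ℂ) (γ : GammaFactor),
    IsDirichletSeries F a → Analyticity F → RamanujanHypothesis a → FunctionalEquation F γ →
    EulerProduct F a → γ.degree < n →
    ∃ l : List (ℂ → ℂ), (∀ P ∈ l, IsPrimitive P ∧ ¬ Set.EqOn P 1 {1}ᶜ) ∧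
      Set.EqOn F l.prod {1}ᶜ := by
  induction n with
  | zero =>
    intro F a γ _ _ _ _ _ hdeg
    exact absurd hdeg (by simpa using γ.degree_nonneg)
  | succ n ih =>
    intro F a γ hF hA hR hγ hE hdeg
    by_cases h1 : Set.EqOn F 1 {1}ᶜ
    · exact ⟨[], by simp, by simpa using h1⟩
    by_cases hprim : IsPrimitive F
    · exact ⟨[F], by simpa using ⟨hprim, h1⟩, by simpa using Set.eqOn_refl F _⟩
    have hS : IsSelberg F := ⟨a, hF, hA, hR, ⟨γ, hγ⟩, hE⟩
    simp only [IsPrimitive, hS, true_and] at hprim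
    push Not at hprim
    obtain ⟨F₁, F₂, ⟨a₁, hF₁, hA₁, hR₁, ⟨γ₁, hγ₁⟩, hE₁⟩, ⟨a₂, hF₂, hA₂, hR₂, ⟨γ₂, hγ₂⟩, hE₂⟩,
      hmul, hne₁, hne₂⟩ := hprim
    have hadd := degree_add_le_of_eqOn_mul hE hE₁ hE₂ hγ hγ₁ hγ₂ hmul
    -- Each nontrivial factor uses at least one unit of degree, leaving less than `n` for the other.
    have hd₁ : 1 ≤ γ₁.degree := by
      by_contra! h
      exact hne₁ (eqOn_one_of_degree_lt_one hF₁ hA₁ hγ₁ hE₁ h)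
    have hd₂ : 1 ≤ γ₂.degree := by
      by_contra! h
      exact hne₂ (eqOn_one_of_degree_lt_one hF₂ hA₂ hγ₂ hE₂ h)
    push_cast at hdeg
    obtain ⟨l₁, hl₁, heq₁⟩ := ih F₁ a₁ γ₁ hF₁ hA₁ hR₁ hγ₁ hE₁ (by linarith)
    obtain ⟨l₂, hl₂, heq₂⟩ := ih F₂ a₂ γ₂ hF₂ hA₂ hR₂ hγ₂ hE₂ (by linarith)
    refine ⟨l₁ ++ l₂, fun P hP => ?_, fun s hs => ?_⟩
    · rcases List.mem_append.mp hP with h | h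
      · exact hl₁ P h
      · exact hl₂ P h
    · rw [hmul hs, List.prod_append, Pi.mul_apply, Pi.mul_apply, heq₁ hs, heq₂ hs]

end SelbergClass

theorem corollary3p3 (F : ℂ → ℂ) (hF : SelbergClass.IsSelberg F) :
    ∃ (r : ℕ) (P : Fin r → ℂ → ℂ),
      (∀ i, SelbergClass.IsPrimitive (P i) ∧ ¬ Set.EqOn (P i) 1 {1}ᶜ) ∧
      Set.EqOn F (∏ i, P i) {1}ᶜ := by
  obtain ⟨a, hD, hA, hR, ⟨γ, hγ⟩, hE⟩ := hF
  obtain ⟨n, hn⟩ := exists_nat_gt γ.degree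
  obtain ⟨l, hl, heq⟩ := SelbergClass.exists_factorization n F a γ hD hA hR hγ hE hn
  refine ⟨l.length, fun i => l[i], fun i => hl _ (List.getElem_mem i.2), ?_⟩
  have hprod : ∏ i : Fin l.length, l[i] = l.prod := Fin.prod_univ_getElem l
  rwa [hprod]
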